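/- Let $d\ge 2$. For $n\ge 1$ let $\Lambda_n=(\mathbb Z/n\mathbb Z)^d$ be the discrete torus with nearest-neighbour edge set $E_n$; configurations $X\in\{0,1\}^{E_n}$ are identified with their sets of open edges, and $c(X)$ is the number of connected components of $(\Lambda_n,X)$. An edge $e$ is a *cut-edge* in $X$ if $c(X\setminus\{e\})\ne c(X\cup\{e\})$. Let $p_{\rm perc}(d)$ be the critical probability of bond percolation on $\mathbb Z^d$ and put $p_{\rm init}=\tfrac12\,(p+p_{\rm perc}(d))$, and, for $q>1$, $p^*=\frac{p}{q(1-p)+p}$. Updates: to the edges of $E_n$ attach independent Poisson processes of rate $1$, and to each of their points an independent uniform mark $U\in[0,1]$. When $e$ is updated with mark $U$ at time $t$ in the FK-dynamics with parameters $p,q$, the edge $e$ becomes closed if $U<1-p$, open if $1-p\le U<1-p+p^*$, and if $U\ge 1-p+p^*$ it becomes closed if $e$ is a cut-edge in $X_{t-}$ and open otherwise; the other edges do not change. For $A\subseteq E_n$ let $A^+=\{e\in E_n: d(e,A)\le \log^4 n\}$, where the distance of two edges is the least graph distance between an endpoint of one and an endpoint of the other (and $\varnothing^+=\varnothing$). Let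 $(Z_t^+)$ and $(Z_t^-)$ be the FK-dynamics on $\{0,1\}^{A^+}$ in which only edges of $A^+$ are updated and all edges of $E_n\setminus A^+$ are kept open (for $Z^+$), respectively closed (for $Z^-$); both use the same updates, which are independent of the initial configuration, and $Z_0^+=Z_0^-$ has a law $\nu$ on $\{0,1\}^{A^+}$. Then there is $p_0=p_0(d)>0$ such that for every $p\in(0,p_0)$ there is $n_0=n_0(d,p)$ such that for all $n\ge n_0$, all $q>1$, all $A\subseteq E_n$, and all probability measures $\nu$ on $\{0,1\}^{A^+}$ that are stochastically dominated by independent bond percolation on $A^+$ with open probability $p_{\rm init}$, $$\mathbb P\big[\,Z_t^+(A)=Z_t^-(A)\ \text{ for all } t\in[0,\log^2 n]\,\big]\ \ge\ 1-\frac1{n^{3d}},$$ where $\mathbb P$ is the joint law of the initial configuration and the updates. -/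

import Mathlib

open MeasureTheory ProbabilityTheory unitInterval

namespace FK

/-- The nearest-neighbour graph on `R ^ d`: `x` and `y` are adjacent when they are distinct and
differ by a unit coordinate vector. -/
def lattice (R : Type) [Ring R] (d : ℕ) : SimpleGraph (Fin d → R) :=
  SimpleGraph.fromRel fun x y => ∃ i : Fin d, y = x + Pi.single i 1

/-- The discrete torus `Λ_n = (ℤ/nℤ)^d`. -/
abbrev torus (d n : ℕ) : SimpleGraph (Fin d → ZMod n) := lattice (ZMod n) d

section Graph

variable {V : Type}

/-- A configuration (an element of `{0,1}^E`) is identified with its set of open edges. -/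
abbrev Config (G : SimpleGraph V) : Type := Set G.edgeSet

/-- The graph `(V, X)` of open edges. -/
def openGraph (G : SimpleGraph V) (X : Config G) : SimpleGraph V :=
  SimpleGraph.fromEdgeSet (Subtype.val '' X)

/-- The number `c(X)` of connected components of `(V, X)`, isolated vertices included. -/
noncomputable def numComponents (G : SimpleGraph V) (X : Config G) : ℕ :=
  Nat.card (openGraph G X).ConnectedComponent

/-- `e` is a cut-edge in `(V, X)`, whether or not `e` itself is open in `X`. -/
def IsCutEdge (G : SimpleGraph V) (X : Config G) (e : G.edgeSet) : Prop :=
  numComponents G (X \ {e}) ≠ numComponents G (X ∪ {e})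

/-- The edges at graph distance at most `r` from the edge set `A`, where the distance of two
edges is the least graph distance between an endpoint of one and an endpoint of the other. -/
def enlarge (G : SimpleGraph V) (r : ℝ) (A : Set G.edgeSet) : Set G.edgeSet :=
  {e | ∃ f ∈ A, ∃ u ∈ (e : Sym2 V), ∃ v ∈ (f : Sym2 V), G.Reachable u v ∧ (G.dist u v : ℝ) ≤ r}

/-! ### Update sequences -/

/-- A realization of the update sequences of all the edges: for each edge `e` and `k : ℕ`, the
waiting time between the `k`-th and the `(k+1)`-st update of `e` (updates being numbered from `1`,
the `0`-th one meaning time `0`), and the mark `U ∈ [0,1]` of the latter. -/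
abbrev Updates (G : SimpleGraph V) : Type := G.edgeSet × ℕ → ℝ × I

/-- The law of the update sequences: independent Poisson processes of rate `1` on the edges
(independent exponential waiting times of mean `1`), with independent uniform marks. -/
noncomputable def updateLaw (G : SimpleGraph V) : Measure (Updates G) :=
  Measure.infinitePi fun _ => (expMeasure 1).prod (volume : Measure I)

/-- The time of the update `a = (e, k)`, the `(k+1)`-st update of the edge `e`. -/
noncomputable def updateTime {G : SimpleGraph V} (ω : Updates G) (a : G.edgeSet × ℕ) : ℝ :=
  ∑ j ∈ Finset.range (a.2 + 1), (ω (a.1, j)).1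

open Classical in
/-- The updates up to time `t`, in chronological order. On a finite graph there are almost surely
finitely many, at distinct times; the value `[]` in the other case is irrelevant. -/
noncomputable def updatesUpTo {G : SimpleGraph V} (ω : Updates G) (t : ℝ) :
    List (G.edgeSet × ℕ) :=
  if h : {a | updateTime ω a ≤ t}.Finite then
    h.toFinset.toList.mergeSort fun a b => decide (updateTime ω a ≤ updateTime ω b)
  else []

/-! ### FK-dynamics -/

/-- `p* = p / (q (1 - p) + p)`. -/
noncomputable def pStar (p q : ℝ) : ℝ := p / (q * (1 - p) + p)

open Classical in
/-- The effect on the configuration `X` of an update of the edge `e` with mark `u`. -/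
noncomputable def update (G : SimpleGraph V) (p q : ℝ) (X : Config G) (e : G.edgeSet) (u : ℝ) :
    Config G :=
  if u < 1 - p then X \ {e}
  else if u < 1 - p + pStar p q then X ∪ {e}
  else if IsCutEdge G X e then X \ {e}
  else X ∪ {e}

open Classical in
/-- The FK-dynamics censored outside `B`, at time `t`, started from the configuration `x` on all
the edges and driven by the updates `ω`: updates of edges outside `B` are ignored, so that the
configuration outside `B` is frozen. Running it with the same `ω` from several starting
configurations is the monotone coupling. -/
noncomputable def censored (G : SimpleGraph V) (p q : ℝ) (B : Set G.edgeSet) (x : Config G)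
    (ω : Updates G) (t : ℝ) : Config G :=
  (updatesUpTo ω t).foldl
    (fun X a => if a.1 ∈ B then update G p q X a.1 ((ω a).2 : ℝ) else X) x

/-- The configuration on all the edges which equals `z` on `B` and `ξ` outside `B`. -/
def glue {G : SimpleGraph V} (B : Set G.edgeSet) (z : Set B) (ξ : Config G) : Config G :=
  Subtype.val '' z ∪ (ξ \ B)

/-- The censored dynamics on `B` with full configuration outside `B`, started from `z` on `B`. -/
noncomputable def dynFull (G : SimpleGraph V) (p q : ℝ) (B : Set G.edgeSet) (z : Set B)
    (ω : Updates G) (t : ℝ) : Config G :=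
  censored G p q B (glue B z Set.univ) ω t

/-- The censored dynamics on `B` with empty configuration outside `B`, started from `z` on `B`. -/
noncomputable def dynEmpty (G : SimpleGraph V) (p q : ℝ) (B : Set G.edgeSet) (z : Set B)
    (ω : Updates G) (t : ℝ) : Config G :=
  censored G p q B (glue B z ∅) ω t

end Graph

/-! ### Percolation -/

/-- Bond percolation on the edge set `B`: every edge of `B` is open with probability `s`,
independently. It is a law on `{0,1}^B`. -/
noncomputable def perc {E : Type} (B : Set E) (s : I) : Measure (Set B) :=
  setBernoulli Set.univ s

/-- Stochastic domination `μ ⪯ π` of laws on `{0,1}^B`: increasing events are at most as likely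
under `μ` as under `π`. -/
def StochDom {E : Type} {B : Set E} (μ π : Measure (Set B)) : Prop :=
  ∀ S : Set (Set B), IsUpperSet S → MeasurableSet S → μ S ≤ π S

/-- The critical probability of bond percolation on `ℤ^d`: the supremum of the `s ∈ [0,1]` for
which the open cluster of the origin is almost surely finite. -/
noncomputable def pPerc (d : ℕ) : I :=
  sSup {s : I | ∀ᵐ X ∂(setBernoulli Set.univ s : Measure (Config (lattice ℤ d))),
    {v | (openGraph (lattice ℤ d) X).Reachable 0 v}.Finite}

/-- `p_init = (p + p_perc(d)) / 2`. -/
noncomputable def pInit (d : ℕ) (p : I) : I :=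
  ⟨((p : ℝ) + pPerc d) / 2,
    by linarith [p.2.1, (pPerc d).2.1], by linarith [p.2.2, (pPerc d).2.2]⟩

end FK

/-! Both dynamics use the same updates, so an edge can become a discrepancy only when it is updated
while being a cut-edge for one configuration and not for the other. Its endpoints are then joined,
by edges open in both configurations, to an edge where the two already differ. Discrepancies
therefore enter from outside `B` and travel along open clusters of the lower dynamics, which lie
inside `B` (`exists_discrepancy_of_isCutEdge`).

Cut the time interval into slabs of fixed length `η`. Whatever the cut-edge rule decides, an update
leaves an edge open only if its mark is at least `1 - p`. Edges found open at an update time of a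
slab thus belong to `slabSet`, which is defined edge by edge from independent data: under initial
percolation of parameter `s` it is a percolation of parameter at most `max s p + η`. Monotonicity in
the initial configuration extends the bound to `ν` (`real_slabSet_le`). Successive jumps of a
discrepancy within one slab stay in a single cluster of `slabSet`, so a slab costs one cluster
radius, however many updates it contains (`discrepancy_near`).

It remains to have exponential decay of the radius at some parameter above both `p` and `p_init`
(`exists_decay`). If `p_perc > 0`, such a parameter exists below `p_perc`, and the argument of
Duminil-Copin and Tassion applies: if `φ(S) ≥ 1` for all finite `S` containing the origin, Russo's
formula gives `f' ≥ 1 - f` for the probability `f` of leaving a box, which contradicts finiteness of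
the cluster at a slightly larger parameter. So `φ(S) < 1` for some `S`, and iterating over copies of
`S` gives the decay, directly on every torus in which `S` and its neighbours embed. The case `p_perc
= 0` need not be excluded: `S = {0}` then suffices.

With radius of order `log n` and `log² n / η` slabs, a union bound over slabs and vertices leaves an
error of at most `n^(-3d)`, and a discrepancy travels at most `log⁴ n`. -/

namespace FK

/-! ### Percolation: reindexing and independence -/

section Bernoulli

variable {E E' : Type*}

lemma setBernoulli_univ_eq_map (p : I) :
    setBernoulli (Set.univ : Set E) p = Measure.map (fun f : E → Prop ↦ {i | f i})
      (Measure.infinitePi fun _ : E ↦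
        toNNReal p • Measure.dirac True + toNNReal (σ p) • Measure.dirac False) := by
  rw [setBernoulli_eq_map]
  simp

/-- Restricting (or reindexing) percolation along an injection gives percolation. -/
lemma map_preimage_setBernoulli {j : E' → E} (hj : Function.Injective j) (p : I) :
    (setBernoulli (Set.univ : Set E) p).map (fun X ↦ j ⁻¹' X) =
      setBernoulli (Set.univ : Set E') p := by
  rw [setBernoulli_univ_eq_map, setBernoulli_univ_eq_map,
    ← Measure.map_infinitePi_infinitePi_of_inj (P := fun _ : E ↦
      toNNReal p • Measure.dirac True + toNNReal (σ p) • Measure.dirac False) hj,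
    Measure.map_map, Measure.map_map]
  · rfl
  · exact MeasurableEquiv.setOfPred.measurable
  · fun_prop
  · exact measurable_set_iff.2 fun a => measurable_set_mem _
  · exact MeasurableEquiv.setOfPred.measurable

lemma setBernoulli_preimage {j : E' → E} (hj : Function.Injective j) (p : I)
    {S : Set (Set E')} (hS : MeasurableSet S) :
    (setBernoulli (Set.univ : Set E) p).real {X | j ⁻¹' X ∈ S} =
      (setBernoulli (Set.univ : Set E') p).real S := by
  rw [← map_preimage_setBernoulli hj, map_measureReal_apply _ hS]
  · rfl
  · exact measurable_set_iff.2 fun a => measurable_set_mem _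

lemma iIndepFun_mem_setBernoulli (p : I) :
    iIndepFun (fun (e : E) (X : Set E) ↦ e ∈ X) (setBernoulli (Set.univ : Set E) p) := by
  have h : iIndepFun (fun (e : E) (f : E → Prop) ↦ f e) (Measure.infinitePi fun _ : E ↦
        toNNReal p • Measure.dirac True + toNNReal (σ p) • Measure.dirac False) :=
    iIndepFun_infinitePi (X := fun _ x ↦ x) (by fun_prop)
  rw [iIndepFun_iff_map_fun_eq_infinitePi_map (by fun_prop)] at h ⊢
  have hm : Measurable (fun f : E → Prop ↦ {i | f i}) := MeasurableEquiv.setOfPred.measurable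
  rw [setBernoulli_univ_eq_map, Measure.map_map (by fun_prop) hm]
  have : ∀ e : E, Measure.map (fun X : Set E ↦ e ∈ X) (Measure.map (fun f : E → Prop ↦ {i | f i})
      (Measure.infinitePi fun _ : E ↦
        toNNReal p • Measure.dirac True + toNNReal (σ p) • Measure.dirac False)) =
      Measure.map (fun f : E → Prop ↦ f e) (Measure.infinitePi fun _ : E ↦
        toNNReal p • Measure.dirac True + toNNReal (σ p) • Measure.dirac False) := by
    intro e
    rw [Measure.map_map (by fun_prop) hm]
    rfl
  simp_rw [this]
  exact h

lemma measurableSet_of_finite [Finite E] (A : Set (Set E)) : MeasurableSet A :=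
  (Set.toFinite A).measurableSet

/-- `A` depends only on the edges of `F`. -/
def DependsOnEdges (F : Set E) (A : Set (Set E)) : Prop :=
  ∀ X Y : Set E, X ∩ F = Y ∩ F → X ∈ A → Y ∈ A

lemma DependsOnEdges.mono {F F' : Set E} {A : Set (Set E)} (h : DependsOnEdges F A) (hF : F ⊆ F') :
    DependsOnEdges F' A := by
  intro X Y hXY
  apply h
  have := congrArg (· ∩ F) hXY
  simpa [Set.inter_assoc, Set.inter_eq_right.2 hF] using this

lemma DependsOnEdges.inter {F : Set E} {A B : Set (Set E)} (hA : DependsOnEdges F A)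
    (hB : DependsOnEdges F B) : DependsOnEdges F (A ∩ B) :=
  fun X Y h hX ↦ ⟨hA X Y h hX.1, hB X Y h hX.2⟩

/-- Events depending on disjoint sets of edges are independent. -/
lemma DependsOnEdges.real_inter [Finite E] {F F' : Set E} (hd : Disjoint F F') {A B : Set (Set E)}
    (hA : DependsOnEdges F A) (hB : DependsOnEdges F' B) (p : I) :
    (setBernoulli (Set.univ : Set E) p).real (A ∩ B) =
      (setBernoulli (Set.univ : Set E) p).real A * (setBernoulli (Set.univ : Set E) p).real B := by
  classical
  have := Fintype.ofFinite E
  have hi := (iIndepFun_mem_setBernoulli (E := E) p).indepFun_finset F.toFinset F'.toFinset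
    (by simpa using hd) (fun e ↦ measurable_set_mem e)
  -- An event depending on `F` is the preimage of its image under restriction to `F`, so
  -- independence of the coordinates applies.
  have key : ∀ {F : Set E} {A : Set (Set E)}, DependsOnEdges F A →
      (fun (X : Set E) (i : F.toFinset) ↦ (i : E) ∈ X) ⁻¹'
        ((fun (X : Set E) (i : F.toFinset) ↦ (i : E) ∈ X) '' A) = A := by
    intro F A hA
    apply Set.Subset.antisymm
    · rintro Y ⟨X, hX, hXY⟩
      refine hA X Y ?_ hX
      ext e
      simp only [Set.mem_inter_iff, and_congr_left_iff]
      intro he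
      have := congrFun hXY ⟨e, by simpa using he⟩
      simpa using this
    · exact Set.subset_preimage_image _ _
  have h := hi.measure_inter_preimage_eq_mul
    ((fun (X : Set E) (i : F.toFinset) ↦ (i : E) ∈ X) '' A)
    ((fun (X : Set E) (i : F'.toFinset) ↦ (i : E) ∈ X) '' B)
    (Set.toFinite _).measurableSet (Set.toFinite _).measurableSet
  rw [key hA, key hB] at h
  simp [measureReal_def, h]

end Bernoulli

/-! ### Russo's formula and monotonicity in the parameter -/

section Russo

variable {E : Type*} [Fintype E]

open Classical in
/-- The weight of the configuration `X` in percolation with parameter `t`. -/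
noncomputable def weight (X : Set E) (t : ℝ) : ℝ := ∏ e, if e ∈ X then t else 1 - t

open Classical in
lemma setBernoulli_real_eq_sum (A : Set (Set E)) (p : I) :
    (setBernoulli (Set.univ : Set E) p).real A = ∑ X : Set E, A.indicator 1 X * weight X p := by
  have h : ∀ X : Set E, (setBernoulli (Set.univ : Set E) p).real {X} = weight X p := by
    intro X
    rw [setBernoulli_real_singleton p (Set.subset_univ X) Set.finite_univ, weight, Finset.prod_ite]
    simp only [Finset.prod_const]
    congr 2
    · rw [Set.ncard_eq_toFinset_card']; congr 1; ext; simp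
    · rw [Set.ncard_eq_toFinset_card']; congr 1; ext; simp
  have hA : A = ⋃ X ∈ (Finset.univ.filter (· ∈ A)), {X} := by ext; simp
  conv_lhs => rw [hA]
  rw [measureReal_biUnion_finset]
  · rw [Finset.sum_filter]
    refine Finset.sum_congr rfl fun X _ ↦ ?_
    by_cases hX : X ∈ A <;> simp [hX, h]
  · intro X _ Y _ hXY
    simpa using hXY
  · intro X _
    exact measurableSet_singleton X

/-- The configurations in which `e` is pivotal for `A`. -/
def pivotal (A : Set (Set E)) (e : E) : Set (Set E) := {X | insert e X ∈ A ∧ X \ {e} ∉ A}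

open Classical in
/-- Russo's formula. -/
lemma hasDerivAt_sum_weight {A : Set (Set E)} (hA : IsUpperSet A) (t : ℝ) :
    HasDerivAt (fun t ↦ ∑ X : Set E, A.indicator 1 X * weight X t)
      (∑ e, ∑ X : Set E, (pivotal A e).indicator 1 X * weight X t) t := by
  have h1 : HasDerivAt (fun t ↦ ∑ X : Set E, A.indicator 1 X * weight X t)
      (∑ X : Set E, A.indicator 1 X * ∑ e, (∏ f ∈ Finset.univ.erase e, if f ∈ X then t else 1 - t) •
        (if e ∈ X then (1 : ℝ) else -1)) t := by
    refine HasDerivAt.fun_sum fun X _ ↦ HasDerivAt.const_mul _ ?_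
    unfold weight
    refine HasDerivAt.fun_finsetProd fun e _ ↦ ?_
    by_cases he : e ∈ X
    · simpa [he] using hasDerivAt_id' t
    · simpa [he] using (hasDerivAt_id' t).const_sub 1
  convert! h1 using 1
  simp_rw [Finset.mul_sum]
  rw [Finset.sum_comm]
  symm
  rw [Finset.sum_comm]
  conv_rhs => rw [Finset.sum_comm]
  refine Finset.sum_congr rfl fun e _ ↦ ?_
  -- Toggling `e` pairs the configurations. The two sums agree pair by pair, though not term by
  -- term, hence the doubling.
  let τ : Equiv.Perm (Set E) := Function.Involutive.toPerm (fun X ↦ symmDiff X {e})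
    (fun X ↦ by simp)
  have two : ∀ g : Set E → ℝ, ∑ X, (g X + g (τ X)) = 2 * ∑ X, g X := by
    intro g
    rw [Finset.sum_add_distrib, Equiv.sum_comp τ g]; ring
  apply mul_left_cancel₀ (two_ne_zero' ℝ)
  rw [← two, ← two]
  refine Finset.sum_congr rfl fun X _ ↦ ?_
  have hw : ∀ Y : Set E, weight Y t = (if e ∈ Y then t else 1 - t) *
      ∏ f ∈ Finset.univ.erase e, if f ∈ Y then t else 1 - t := by
    intro Y
    rw [weight, Finset.mul_prod_erase Finset.univ (fun f ↦ if f ∈ Y then t else 1 - t)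
      (Finset.mem_univ e)]
  have hW : (∏ f ∈ Finset.univ.erase e, if f ∈ τ X then t else 1 - t) =
      ∏ f ∈ Finset.univ.erase e, if f ∈ X then t else 1 - t := by
    refine Finset.prod_congr rfl fun f hf ↦ ?_
    have : f ∈ τ X ↔ f ∈ X := by
      change f ∈ symmDiff X {e} ↔ _
      simp [Set.mem_symmDiff, Finset.ne_of_mem_erase hf]
    simp [this]
  have hle : X \ {e} ∈ A → insert e X ∈ A := fun h ↦ hA (by
    intro x hx; exact Or.inr hx.1) h
  rw [hw X, hw (τ X), hW]
  generalize (∏ f ∈ Finset.univ.erase e, if f ∈ X then t else 1 - t) = W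
  by_cases he : e ∈ X
  · have h2 : τ X = X \ {e} := by
      change symmDiff X {e} = _
      ext f; by_cases hf : f = e <;> simp [Set.mem_symmDiff, hf, he]
    have h3 : insert e X = X := Set.insert_eq_of_mem he
    have h4 : insert e (X \ {e}) = X := by simp [he]
    have h5 : (X \ {e}) \ {e} = X \ {e} := by simp
    rw [h2]
    by_cases a : X ∈ A <;> by_cases b : X \ {e} ∈ A <;>
      simp [pivotal, Set.indicator, he, h3, h4, h5, a, b] at hle ⊢ <;> ring
  · have h2 : τ X = insert e X := by
      change symmDiff X {e} = _
      ext f; by_cases hf : f = e <;> simp [Set.mem_symmDiff, hf, he]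
    have h3 : X \ {e} = X := by simp [he]
    have h4 : (insert e X) \ {e} = X := by simp [he]
    rw [h2]
    by_cases a : X ∈ A <;> by_cases b : insert e X ∈ A <;>
      simp [pivotal, Set.indicator, he, h3, h4, a, b] at hle ⊢ <;> ring

open Classical in
lemma sum_pivotal_nonneg (A : Set (Set E)) {t : ℝ} (h0 : 0 ≤ t) (h1 : t ≤ 1) :
    0 ≤ ∑ e, ∑ X : Set E, (pivotal A e).indicator (1 : Set E → ℝ) X * weight X t := by
  refine Finset.sum_nonneg fun e _ ↦ Finset.sum_nonneg fun X _ ↦ mul_nonneg ?_ ?_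
  · exact Set.indicator_nonneg (fun _ _ ↦ zero_le_one) _
  · refine Finset.prod_nonneg fun f _ ↦ ?_
    split_ifs <;> linarith

/-- Increasing events are more likely for a larger parameter. -/
lemma setBernoulli_real_mono {A : Set (Set E)} (hA : IsUpperSet A) {p p' : I} (h : p ≤ p') :
    (setBernoulli (Set.univ : Set E) p).real A ≤ (setBernoulli (Set.univ : Set E) p').real A := by
  classical
  rw [setBernoulli_real_eq_sum, setBernoulli_real_eq_sum]
  have hm : MonotoneOn (fun t ↦ ∑ X : Set E, A.indicator 1 X * weight X t) (Set.Icc (0 : ℝ) 1) := by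
    refine monotoneOn_of_deriv_nonneg (convex_Icc 0 1)
      (fun t _ ↦ (hasDerivAt_sum_weight hA t).continuousAt.continuousWithinAt)
      (fun t _ ↦ (hasDerivAt_sum_weight hA t).differentiableAt.differentiableWithinAt)
      fun t ht ↦ ?_
    rw [interior_Icc] at ht
    rw [(hasDerivAt_sum_weight hA t).deriv]
    exact sum_pivotal_nonneg A ht.1.le ht.2.le
  exact hm p.2 p'.2 h

end Russo


/-! ### Connectivity by open paths, and the quantity `φ` -/

section Reachable

variable {V : Type*} {H : SimpleGraph V} {u v : V}

lemma mem_of_reachable {C : Set V} (hC : ∀ a b, a ∈ C → H.Adj a b → b ∈ C)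
    (h : H.Reachable u v) (hu : u ∈ C) : v ∈ C := by
  obtain ⟨w⟩ := h
  induction w with
  | nil => exact hu
  | cons hadj _ ih => exact ih (hC _ _ hu hadj)

lemma exists_adj_of_reachable {C : Set V} (h : H.Reachable u v) (hu : u ∈ C) (hv : v ∉ C) :
    ∃ a b, a ∈ C ∧ b ∉ C ∧ H.Adj a b := by
  by_contra! hcon
  exact hv (mem_of_reachable (fun a b ha hab ↦ by_contra fun hb ↦ hcon a b ha hb hab) h hu)

/-- There is a walk of length at most `m` from `u` to `v`. -/
def Near (G : SimpleGraph V) (m : ℕ) (u v : V) : Prop := ∃ w : G.Walk u v, w.length ≤ m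

lemma Near.refl (G : SimpleGraph V) (u : V) : Near G 0 u u := ⟨.nil, le_rfl⟩

lemma Near.symm {G : SimpleGraph V} {m : ℕ} (h : Near G m u v) : Near G m v u := by
  obtain ⟨w, hw⟩ := h
  exact ⟨w.reverse, by simpa using hw⟩

lemma Near.trans {G : SimpleGraph V} {m k : ℕ} {x : V} (h : Near G m u v) (h' : Near G k v x) :
    Near G (m + k) u x := by
  obtain ⟨w, hw⟩ := h
  obtain ⟨w', hw'⟩ := h'
  exact ⟨w.append w', by rw [SimpleGraph.Walk.length_append]; omega⟩

lemma Near.mono {G : SimpleGraph V} {m k : ℕ} (h : Near G m u v) (hmk : m ≤ k) : Near G k u v := by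
  obtain ⟨w, hw⟩ := h
  exact ⟨w, hw.trans hmk⟩

end Reachable

section OpenIn

variable {V : Type*}

/-- The graph of the edges of `G` inside `S` which are open in `X`. -/
def openIn (G : SimpleGraph V) (S : Set V) (X : Set (Sym2 V)) : SimpleGraph V where
  Adj u v := G.Adj u v ∧ s(u, v) ∈ X ∧ u ∈ S ∧ v ∈ S
  symm := ⟨fun u v h ↦ ⟨h.1.symm, by rw [Sym2.eq_swap]; exact h.2.1, h.2.2.2, h.2.2.1⟩⟩
  loopless := ⟨fun u h ↦ G.loopless.irrefl u h.1⟩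

lemma openIn_mono (G : SimpleGraph V) {S S' : Set V} {X X' : Set (Sym2 V)} (hS : S ⊆ S')
    (hX : X ⊆ X') : openIn G S X ≤ openIn G S' X' :=
  fun _ _ h ↦ ⟨h.1, hX h.2.1, hS h.2.2.1, hS h.2.2.2⟩

/-- The event that `o` and `u` are connected inside `S`. -/
def connIn (G : SimpleGraph V) (S : Set V) (o u : V) : Set (Set (Sym2 V)) :=
  {X | (openIn G S X).Reachable o u}

lemma isUpperSet_connIn (G : SimpleGraph V) (S : Set V) (o u : V) :
    IsUpperSet (connIn G S o u) :=
  fun _ _ h hX ↦ SimpleGraph.Reachable.mono (openIn_mono G subset_rfl h) hX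

lemma dependsOnEdges_adj_openIn {G : SimpleGraph V} {S : Set V} {F X Y : Set (Sym2 V)}
    (h : X ∩ F = Y ∩ F) {a b : V} (hF : s(a, b) ∈ F) (ha : (openIn G S X).Adj a b) :
    (openIn G S Y).Adj a b := by
  refine ⟨ha.1, ?_, ha.2.2⟩
  have : s(a, b) ∈ X ∩ F := ⟨ha.2.1, hF⟩
  rw [h] at this
  exact this.1

lemma dependsOnEdges_connIn (G : SimpleGraph V) (S : Set V) (o u : V) :
    DependsOnEdges S.sym2 (connIn G S o u) := by
  intro X Y h hX
  refine SimpleGraph.Reachable.mono (fun a b hab ↦ dependsOnEdges_adj_openIn h ?_ hab) hX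
  simpa using hab.2.2

/-- The quantity `φ_p(S) = p ∑ P_p(o ↔ u in S)`, the sum being over the edges `uv` of `G` leaving
the finite set `S`. -/
noncomputable def phi (G : SimpleGraph V) (p : I) (S : Finset V) (o : V) : ℝ :=
  p * ∑ u ∈ S, (setBernoulli Set.univ p).real (connIn G S o u) * {v | v ∉ S ∧ G.Adj u v}.ncard

lemma reachable_openIn_range_iff {T : Type*} {g : T → V} (hg : Function.Injective g)
    {G : SimpleGraph V} {H : SimpleGraph T} (hadj : ∀ a b, G.Adj (g a) (g b) ↔ H.Adj a b)
    (X : Set (Sym2 V)) (a b : T) :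
    (openIn G (Set.range g) X).Reachable (g a) (g b) ↔
      (openIn H Set.univ (Sym2.map g ⁻¹' X)).Reachable a b := by
  constructor
  · intro h
    have := mem_of_reachable (C := g '' {c | (openIn H Set.univ (Sym2.map g ⁻¹' X)).Reachable a c})
      ?_ h ⟨a, SimpleGraph.Reachable.refl _, rfl⟩
    · obtain ⟨c, hc, hcb⟩ := this
      rwa [← hg hcb]
    · rintro _ _ ⟨c, hc, rfl⟩ ⟨h1, h2, -, ⟨d, rfl⟩⟩
      refine ⟨d, hc.trans (SimpleGraph.Adj.reachable ⟨(hadj _ _).1 h1, ?_, trivial, trivial⟩), rfl⟩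
      simpa using h2
  · intro h
    refine h.map (⟨g, ?_⟩ : openIn H Set.univ (Sym2.map g ⁻¹' X) →g openIn G (Set.range g) X)
    intro c d hcd
    exact ⟨(hadj _ _).2 hcd.1, by simpa using hcd.2.1, ⟨c, rfl⟩, ⟨d, rfl⟩⟩

/-- The probability of a connection inside a finite set depends only on the induced graph. -/
lemma real_connIn_range {T : Type*} [Finite T] {g : T → V} (hg : Function.Injective g)
    {G : SimpleGraph V} {H : SimpleGraph T} (hadj : ∀ a b, G.Adj (g a) (g b) ↔ H.Adj a b)
    (p : I) (a b : T) :
    (setBernoulli Set.univ p).real (connIn G (Set.range g) (g a) (g b)) =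
      (setBernoulli Set.univ p).real (connIn H Set.univ a b) := by
  rw [← setBernoulli_preimage (Sym2.map.injective hg) p (measurableSet_of_finite _)]
  congr 1
  ext X
  exact reachable_openIn_range_iff hg hadj X a b

lemma real_connIn_image {V' : Type*} {G : SimpleGraph V} {G' : SimpleGraph V'} {f : V → V'}
    {S : Finset V} (hf : Set.InjOn f S)
    (hadj : ∀ u ∈ S, ∀ v ∈ S, G'.Adj (f u) (f v) ↔ G.Adj u v) (p : I) {o u : V}
    (ho : o ∈ S) (hu : u ∈ S) :
    (setBernoulli Set.univ p).real (connIn G' (f '' S) (f o) (f u)) =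
      (setBernoulli Set.univ p).real (connIn G S o u) := by
  have h1 := real_connIn_range (T := S) (g := fun x ↦ (x : V)) Subtype.val_injective (G := G)
    (H := G.comap (fun x : S ↦ (x : V))) (fun _ _ ↦ Iff.rfl) p ⟨o, ho⟩ ⟨u, hu⟩
  have h2 := real_connIn_range (T := S) (g := fun x ↦ f x) (G := G')
    (fun x y h ↦ Subtype.ext (hf x.2 y.2 h))
    (H := G.comap (fun x : S ↦ (x : V))) (fun a b ↦ hadj _ a.2 _ b.2) p ⟨o, ho⟩ ⟨u, hu⟩
  have r1 : Set.range (fun x : S ↦ (x : V)) = S := by simp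
  have r2 : Set.range (fun x : S ↦ f x) = f '' S := by ext; simp
  rw [r1] at h1
  rw [r2] at h2
  rw [h1, h2]

lemma phi_mono (G : SimpleGraph V) {p p' : I} (h : p ≤ p') (S : Finset V) {o : V} (ho : o ∈ S) :
    phi G p S o ≤ phi G p' S o := by
  unfold phi
  refine mul_le_mul h (Finset.sum_le_sum fun u hu ↦ mul_le_mul_of_nonneg_right ?_ (by positivity))
    (Finset.sum_nonneg fun u _ ↦ by positivity) p'.2.1
  -- Monotonicity in the parameter was proved for finite edge sets, so the connection is moved to
  -- the graph induced on `S`.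
  have h1 := fun q ↦ real_connIn_range (T := S) (g := fun x ↦ (x : V)) Subtype.val_injective
    (G := G) (H := G.comap (fun x : S ↦ (x : V))) (fun _ _ ↦ Iff.rfl) q ⟨o, ho⟩ ⟨u, hu⟩
  have r1 : Set.range (fun x : S ↦ (x : V)) = S := by simp
  rw [r1] at h1
  have := Fintype.ofFinite (Sym2 S)
  rw [h1, h1]
  exact setBernoulli_real_mono (isUpperSet_connIn _ _ _ _) h

end OpenIn

/-! ### Differential inequality for the probability of reaching a set -/

section Sharpness

variable {W : Type*} (H : SimpleGraph W) (D : Set W)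

/-- The event that `x` is connected to `D`. -/
def connTo (x : W) : Set (Set (Sym2 W)) :=
  {X | ∃ z ∈ D, (openIn H Set.univ X).Reachable x z}

lemma isUpperSet_connTo (x : W) : IsUpperSet (connTo H D x) := by
  rintro X Y h ⟨z, hz, hX⟩
  exact ⟨z, hz, hX.mono (openIn_mono H subset_rfl h)⟩

variable {H D} in
lemma connTo_of_adj {X : Set (Sym2 W)} {a b : W} (h : (openIn H Set.univ X).Adj a b)
    (hb : X ∈ connTo H D b) : X ∈ connTo H D a := by
  obtain ⟨z, hz, hr⟩ := hb
  exact ⟨z, hz, h.reachable.trans hr⟩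

/-- The event that `S` is the set of the vertices not connected to `D`. -/
def nonConnSet (S : Set W) : Set (Set (Sym2 W)) := {X | {x | X ∉ connTo H D x} = S}

/-- Exploring the clusters of `D` examines only edges with an endpoint outside `S`: the exploration
stops at the boundary of `S`, whose edges are closed. -/
lemma dependsOnEdges_nonConnSet (S : Set W) : DependsOnEdges S.sym2ᶜ (nonConnSet H D S) := by
  intro X Y h hX
  have hS : ∀ x, x ∈ S ↔ X ∉ connTo H D x := fun x ↦ by rw [← hX]; rfl
  have hDS : ∀ z ∈ D, z ∉ S := fun z hz hzS ↦ (hS z).1 hzS ⟨z, hz, .refl _⟩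
  change {x | Y ∉ connTo H D x} = S
  ext x
  constructor
  · intro hx
    by_contra hxS
    obtain ⟨z, hz, hr⟩ := not_not.1 (mt (hS x).2 hxS)
    refine hx (mem_of_reachable (C := {w | w ∉ S ∧ Y ∈ connTo H D w}) ?_ hr.symm
      ⟨hDS z hz, z, hz, .refl _⟩).2
    rintro a b ⟨haS, haY⟩ hab
    have hb : b ∉ S := fun hb ↦
      (hS b).1 hb (connTo_of_adj hab.symm (not_not.1 (mt (hS a).2 haS)))
    refine ⟨hb, connTo_of_adj (SimpleGraph.Adj.symm (dependsOnEdges_adj_openIn h ?_ hab)) haY⟩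
    simp [haS]
  · rintro hx ⟨z, hz, hr⟩
    obtain ⟨a, b, ha, hb, hab⟩ := exists_adj_of_reachable hr hx (hDS z hz)
    exact (hS a).1 ha (connTo_of_adj (dependsOnEdges_adj_openIn h.symm (by simp [hb]) hab)
      (not_not.1 (mt (hS b).2 hb)))

variable [Fintype W]

open Classical in
/-- The key inequality in the sharpness theorem: a lower bound for the number of pivotal edges. -/
lemma one_sub_real_connTo_le (p : I) (o : W)
    (hφ : ∀ S : Finset W, o ∈ S → Disjoint (S : Set W) D → 1 ≤ phi H p S o) :
    1 - (setBernoulli Set.univ p).real (connTo H D o) ≤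
      ∑ e, (setBernoulli Set.univ p).real (pivotal (connTo H D o) e) := by
  set μ : Measure (Set (Sym2 W)) := setBernoulli Set.univ p with hμ
  let B : Finset W → Set (Set (Sym2 W)) := fun S ↦ nonConnSet H D S
  let K : Finset W × W × W → Set (Set (Sym2 W)) := fun i ↦ B i.1 ∩ connIn H i.1 o i.2.1
  let T : Finset (Finset W × W × W) :=
    Finset.univ.filter fun i ↦ o ∈ i.1 ∧ i.2.1 ∈ i.1 ∧ i.2.2 ∉ i.1 ∧ H.Adj i.2.1 i.2.2
  have hBdisj : ∀ S S' : Finset W, S ≠ S' → Disjoint (B S) (B S') := by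
    intro S S' hne
    refine Set.disjoint_left.2 fun X h h' ↦ hne ?_
    exact Finset.coe_injective (h.symm.trans h')
  have h1 : 1 - μ.real (connTo H D o) = ∑ S with o ∈ S, μ.real (B S) := by
    rw [← probReal_compl_eq_one_sub (measurableSet_of_finite _),
      ← measureReal_biUnion_finset (fun S _ S' _ h ↦ hBdisj S S' h)
        (fun S _ ↦ measurableSet_of_finite _)]
    congr 1
    ext X
    simp only [Set.mem_compl_iff, Finset.mem_filter, Finset.mem_univ, true_and, Set.mem_iUnion,
      exists_prop]
    constructor
    · intro h
      exact ⟨Finset.univ.filter fun x ↦ X ∉ connTo H D x, by simpa using h,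
        by simp [B, nonConnSet]⟩
    · rintro ⟨S, hS, hX⟩
      have : o ∈ {x | X ∉ connTo H D x} := by
        rw [show {x | X ∉ connTo H D x} = S from hX]; exact hS
      exact this
  -- The event `B S` leaves the edges inside `S` unexplored, so it is independent of connections
  -- there, and `φ ≥ 1` (with its factor `p ≤ 1` dropped) bounds the sum from below. If `S` meets
  -- `D`, then `B S` is empty.
  have h2 : ∀ S : Finset W, o ∈ S → μ.real (B S) ≤
      ∑ u ∈ S, ∑ v with v ∉ S ∧ H.Adj u v, μ.real (K (S, u, v)) := by
    intro S hS
    by_cases hD : Disjoint (S : Set W) D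
    · have hK : ∀ u v, μ.real (K (S, u, v)) = μ.real (B S) * μ.real (connIn H S o u) := fun u v ↦
        (dependsOnEdges_nonConnSet H D S).real_inter disjoint_compl_left
          (dependsOnEdges_connIn H S o u) p
      simp only [hK]
      have hsum : ∑ u ∈ S, ∑ v with v ∉ S ∧ H.Adj u v, μ.real (B S) * μ.real (connIn H S o u) =
          μ.real (B S) * ∑ u ∈ S, μ.real (connIn H S o u) * {v | v ∉ S ∧ H.Adj u v}.ncard := by
        rw [Finset.mul_sum]
        refine Finset.sum_congr rfl fun u _ ↦ ?_
        rw [Finset.sum_const, nsmul_eq_mul, Set.ncard_eq_toFinset_card']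
        simp only [Set.toFinset_ofPred]
        ring
      rw [hsum]
      refine le_mul_of_one_le_right measureReal_nonneg ((hφ S hS hD).trans ?_)
      exact mul_le_of_le_one_left (Finset.sum_nonneg fun u _ ↦ by positivity) p.2.2
    · have : B S = ∅ := by
        rw [Set.eq_empty_iff_forall_notMem]
        intro X hX
        apply hD
        refine Set.disjoint_left.2 fun z hz hzD ↦ ?_
        rw [← show {x | X ∉ connTo H D x} = S from hX] at hz
        exact hz ⟨z, hzD, .refl _⟩
      rw [this, measureReal_empty]
      exact Finset.sum_nonneg fun u _ ↦ Finset.sum_nonneg fun v _ ↦ measureReal_nonneg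
  have h3 : ∑ S with o ∈ S, ∑ u ∈ S, ∑ v with v ∉ S ∧ H.Adj u v, μ.real (K (S, u, v)) =
      ∑ i ∈ T, μ.real (K i) := by
    simp only [T, Finset.sum_filter, Fintype.sum_prod_type]
    refine Finset.sum_congr rfl fun S _ ↦ ?_
    by_cases ho : o ∈ S
    · simp only [ho, if_true, true_and]
      rw [← Finset.sum_filter_add_sum_filter_not Finset.univ (· ∈ S)]
      rw [Finset.filter_mem_eq_inter, Finset.univ_inter]
      rw [Finset.sum_eq_zero (s := Finset.univ.filter fun x ↦ x ∉ S), add_zero]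
      · refine Finset.sum_congr rfl fun u hu ↦ ?_
        simp [hu]
      · intro u hu
        simp only [Finset.mem_filter, Finset.mem_univ, true_and] at hu
        simp [hu]
    · simp [ho]
  rw [h1]
  refine (Finset.sum_le_sum fun S hS ↦ h2 S (by simpa using hS)).trans ?_
  -- Regroup by the edge `uv`. Each event makes `uv` pivotal, and for a given edge the events are
  -- disjoint: the configuration determines `S`, and then `u` is the endpoint lying in `S`.
  rw [h3, ← Finset.sum_fiberwise T (fun i ↦ s(i.2.1, i.2.2))]
  refine Finset.sum_le_sum fun e _ ↦ ?_
  rw [← measureReal_biUnion_finset _ (fun S _ ↦ measurableSet_of_finite _)]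
  · refine measureReal_mono ?_
    refine Set.iUnion₂_subset ?_
    rintro ⟨S, u, v⟩ hi X ⟨hX1, hX2⟩
    simp only [T, Finset.mem_filter, Finset.mem_univ, true_and] at hi
    obtain ⟨⟨hoS, huS, hvS, hadj⟩, rfl⟩ := hi
    have hS : ∀ x, x ∈ S ↔ X ∉ connTo H D x := fun x ↦ by
      rw [← Finset.mem_coe, ← show {x | X ∉ connTo H D x} = S from hX1]; rfl
    constructor
    · obtain ⟨z, hz, hr⟩ := not_not.1 (mt (hS v).2 hvS)
      have hle : openIn H Set.univ X ≤ openIn H Set.univ (insert s(u, v) X) :=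
        openIn_mono H subset_rfl (Set.subset_insert _ _)
      refine ⟨z, hz, ?_⟩
      refine (SimpleGraph.Reachable.mono (openIn_mono H (Set.subset_univ _)
        (Set.subset_insert _ _)) hX2).trans (SimpleGraph.Reachable.trans
        (SimpleGraph.Adj.reachable ?_) (hr.mono hle))
      exact ⟨hadj, Set.mem_insert _ _, trivial, trivial⟩
    · exact fun h ↦ (hS o).1 hoS (isUpperSet_connTo H D o Set.sdiff_subset h)
  · rintro ⟨S, u, v⟩ hi ⟨S', u', v'⟩ hi' hne
    refine Set.disjoint_left.2 fun X hX hX' ↦ hne ?_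
    simp only [T, Finset.coe_filter, Finset.mem_filter, Finset.mem_univ, true_and,
      Set.mem_ofPred_eq] at hi hi'
    have hSS : S = S' := by
      by_contra h
      exact Set.disjoint_left.1 (hBdisj S S' h) hX.1 hX'.1
    subst hSS
    have := hi.2.trans hi'.2.symm
    rcases Sym2.eq_iff.1 this with ⟨rfl, rfl⟩ | ⟨rfl, rfl⟩
    · rfl
    · exact absurd hi.1.2.1 hi'.1.2.2.1

/-- If `φ ≥ 1` for all the sets at parameter `p`, then `D` is reached with a uniformly positive
probability at any larger parameter. -/
lemma one_sub_exp_le_real_connTo {p p' : I} (hp : p ≤ p') (o : W)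
    (hφ : ∀ S : Finset W, o ∈ S → Disjoint (S : Set W) D → 1 ≤ phi H p S o) :
    1 - Real.exp (-((p' : ℝ) - p)) ≤ (setBernoulli Set.univ p').real (connTo H D o) := by
  classical
  have hA := isUpperSet_connTo H D o
  let F : ℝ → ℝ := fun t ↦ ∑ X : Set (Sym2 W), (connTo H D o).indicator 1 X * weight X t
  let F' : ℝ → ℝ := fun t ↦ ∑ e, ∑ X : Set (Sym2 W),
    (pivotal (connTo H D o) e).indicator 1 X * weight X t
  have hF : ∀ t, HasDerivAt F (F' t) t := fun t ↦ hasDerivAt_sum_weight hA t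
  -- Integrating factor for `F' ≥ 1 - F`, which holds on the whole interval because `φ ≥ 1` persists
  -- when the parameter grows.
  have hG : ∀ t, HasDerivAt (fun t ↦ (1 - F t) * Real.exp t)
      (-F' t * Real.exp t + (1 - F t) * Real.exp t) t := fun t ↦
    ((hF t).const_sub 1).mul (Real.hasDerivAt_exp t)
  have hanti : AntitoneOn (fun t ↦ (1 - F t) * Real.exp t) (Set.Icc (p : ℝ) p') := by
    refine antitoneOn_of_deriv_nonpos (convex_Icc _ _)
      (fun t _ ↦ (hG t).continuousAt.continuousWithinAt)
      (fun t _ ↦ (hG t).differentiableAt.differentiableWithinAt) fun t ht ↦ ?_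
    rw [interior_Icc] at ht
    rw [(hG t).deriv]
    let q : I := ⟨t, p.2.1.trans ht.1.le, ht.2.le.trans p'.2.2⟩
    have hpq : p ≤ q := ht.1.le
    have := one_sub_real_connTo_le H D q o fun S h1 h2 ↦
      (hφ S h1 h2).trans (phi_mono H hpq S h1)
    simp only [setBernoulli_real_eq_sum] at this
    change 1 - F t ≤ F' t at this
    nlinarith [Real.exp_pos t]
  have h := hanti (Set.left_mem_Icc.2 hp) (Set.right_mem_Icc.2 hp) hp
  have hFp : ∀ q : I, F q = (setBernoulli Set.univ q).real (connTo H D o) := fun q ↦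
    (setBernoulli_real_eq_sum _ q).symm
  simp only [hFp] at h
  have h0 : 0 ≤ (setBernoulli Set.univ p).real (connTo H D o) := measureReal_nonneg
  have h4 : (1 - (setBernoulli Set.univ p').real (connTo H D o)) * Real.exp p' ≤ Real.exp p :=
    h.trans (mul_le_of_le_one_left (Real.exp_pos _).le (by linarith))
  rw [neg_sub, Real.exp_sub]
  have := (le_div_iff₀ (Real.exp_pos (p' : ℝ))).2 h4
  linarith

end Sharpness


/-! ### Exponential decay of the cluster radius on a finite graph -/

section Decay

variable {V : Type*} (G : SimpleGraph V)

/-- The event that `x` is connected inside `S` to a vertex at distance more than `m` from `x`. -/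
def farIn (S : Set V) (m : ℕ) (x : V) : Set (Set (Sym2 V)) :=
  {X | ∃ y, (openIn G S X).Reachable x y ∧ ¬ Near G m x y}

lemma dependsOnEdges_farIn (S : Set V) (m : ℕ) (x : V) :
    DependsOnEdges S.sym2 (farIn G S m x) := by
  rintro X Y h ⟨y, hy, hn⟩
  exact ⟨y, dependsOnEdges_connIn G S x y X Y h hy, hn⟩

/-- The event that `C` is the cluster of `x` inside `S`. -/
def clusterIn (S : Set V) (x : V) (C : Set V) : Set (Set (Sym2 V)) :=
  {X | {w | (openIn G S X).Reachable x w} = C}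

/-- Exploring the cluster of `x` inside `S` examines only the edges inside `S` that touch it. -/
lemma dependsOnEdges_clusterIn (S : Set V) (x : V) (C : Set V) :
    DependsOnEdges {e | e ∈ S.sym2 ∧ ∃ a ∈ e, a ∈ C} (clusterIn G S x C) := by
  intro X Y h hX
  have hC : ∀ w, w ∈ C ↔ (openIn G S X).Reachable x w := fun w ↦ by rw [← hX]; rfl
  have hxC : x ∈ C := (hC x).2 (.refl _)
  have hmem : ∀ {a b : V} {Z : Set (Sym2 V)}, a ∈ C → (openIn G S Z).Adj a b →
      s(a, b) ∈ {e | e ∈ S.sym2 ∧ ∃ a ∈ e, a ∈ C} := fun {a b Z} ha hab ↦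
    ⟨by simpa using hab.2.2, a, by simp, ha⟩
  change {w | (openIn G S Y).Reachable x w} = C
  ext w
  constructor
  · intro hw
    refine mem_of_reachable ?_ hw hxC
    intro a b ha hab
    exact (hC b).2 (((hC a).1 ha).trans (dependsOnEdges_adj_openIn h.symm (hmem ha hab) hab).reachable)
  · intro hw
    refine (mem_of_reachable (C := {w | w ∈ C ∧ (openIn G S Y).Reachable x w}) ?_ ((hC w).1 hw)
      ⟨hxC, .refl _⟩).2
    rintro a b ⟨ha, haY⟩ hab
    exact ⟨(hC b).2 (((hC a).1 ha).trans hab.reachable),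
      haY.trans (dependsOnEdges_adj_openIn h (hmem ha hab) hab).reachable⟩

lemma setBernoulli_real_mem {E : Type*} (e : E) (p : I) :
    (setBernoulli (Set.univ : Set E) p).real {X | e ∈ X} = p := by
  have h := setBernoulli_preimage (j := fun _ : Unit ↦ e) (fun _ _ _ ↦ rfl) p
    (S := {Set.univ}) (measurableSet_of_finite _)
  rw [setBernoulli_real_singleton p subset_rfl Set.finite_univ] at h
  simp only [Set.ncard_univ, Nat.card_unique, pow_one, sdiff_self, Set.bot_eq_empty,
    Set.ncard_empty, pow_zero, mul_one] at h
  rw [← h]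
  congr 1
  ext X
  simp only [Set.mem_ofPred_eq, Set.mem_singleton_iff, Set.eq_univ_iff_forall, Set.mem_preimage]
  exact ⟨fun h _ ↦ h, fun h ↦ h ()⟩

lemma dependsOnEdges_mem {E : Type*} (e : E) : DependsOnEdges {e} {X : Set E | e ∈ X} := by
  intro X Y h hX
  have : e ∈ X ∩ {e} := ⟨hX, rfl⟩
  rw [h] at this
  exact this.1

variable [Fintype V]

/-- Exponential decay of the radius of a cluster, when `φ(S) ≤ c` for a suitable set `S` around
every vertex. -/
theorem real_farIn_le_pow {p : I} {c : ℝ} (S : V → Finset V) {L : ℕ} (hxS : ∀ x, x ∈ S x)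
    (hSL : ∀ x, ∀ u ∈ S x, Near G L x u)
    (hL : ∀ x, ∀ u ∈ S x, ∀ v ∉ S x, G.Adj u v → Near G L x v)
    (hφ : ∀ x, phi G p (S x) x ≤ c) (k : ℕ) (x : V) :
    (setBernoulli Set.univ p).real (farIn G Set.univ (k * L) x) ≤ c ^ k := by
  classical
  induction k generalizing x with
  | zero => simp
  | succ k ih =>
    set μ : Measure (Set (Sym2 V)) := setBernoulli Set.univ p with hμ
    have hc : 0 ≤ c ^ k := measureReal_nonneg.trans (ih x)
    let B : Finset V → Set (Set (Sym2 V)) := fun C ↦ clusterIn G (S x) x C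
    let T : Finset (V × V) := Finset.univ.filter fun i ↦ i.1 ∈ S x ∧ i.2 ∉ S x ∧ G.Adj i.1 i.2
    let R : V → Finset (Finset V) := fun u ↦ (S x).powerset.filter fun C ↦ u ∈ C
    let K : V × V → Finset V → Set (Set (Sym2 V)) := fun i C ↦
      (B C ∩ {X | s(i.1, i.2) ∈ X}) ∩ farIn G (C : Set V)ᶜ (k * L) i.2
    have hsub : farIn G Set.univ ((k + 1) * L) x ⊆ ⋃ i ∈ T, ⋃ C ∈ R i.1, K i C := by
      rintro X ⟨y, hy, hn⟩
      let C : Finset V := Finset.univ.filter fun w ↦ (openIn G (S x) X).Reachable x w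
      have hC : ∀ w, w ∈ C ↔ (openIn G (S x) X).Reachable x w := fun w ↦ by simp [C]
      have hCS : ∀ w ∈ C, w ∈ S x := fun w hw ↦ by
        have := mem_of_reachable (C := (S x : Set V))
          (fun a b _ (hab : (openIn G (S x) X).Adj a b) ↦ hab.2.2.2) ((hC w).1 hw)
          (hxS x)
        exact this
      have hyC : y ∉ C := fun h ↦ hn ((hSL x y (hCS y h)).mono (Nat.le_mul_of_pos_left L k.succ_pos))
      -- The component of `y` off `C` can be left only by an edge `vu` entering `C`. As `C` is a
      -- full cluster inside `S x`, the vertex `v` lies outside `S x`.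
      obtain ⟨v, u, hv, hu, hvu⟩ := exists_adj_of_reachable
        (C := {w | w ∉ C ∧ (openIn G (C : Set V)ᶜ X).Reachable w y}) hy.symm
        ⟨hyC, .refl _⟩ (fun h ↦ h.1 ((hC x).2 (.refl _)))
      have huC : u ∈ C := by
        by_contra huC
        refine hu ⟨huC, SimpleGraph.Reachable.trans (SimpleGraph.Adj.reachable ?_) hv.2⟩
        exact ⟨hvu.1.symm, hvu.symm.2.1, by simpa using huC, by simpa using hv.1⟩
      have hvS : v ∉ S x := by
        intro hvS
        refine hv.1 ((hC v).2 (((hC u).1 huC).trans (SimpleGraph.Adj.reachable ?_)))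
        exact ⟨hvu.1.symm, hvu.symm.2.1, by simpa using hCS u huC, by simpa using hvS⟩
      simp only [Set.mem_iUnion, exists_prop]
      refine ⟨(u, v), by simp [T, hCS u huC, hvS, hvu.1.symm], C,
        by simp only [R, Finset.mem_filter, Finset.mem_powerset]; exact ⟨hCS, huC⟩, ⟨?_, hvu.symm.2.1⟩, y, hv.2, fun h ↦ hn ?_⟩
      · change {w | (openIn G (S x) X).Reachable x w} = C
        ext w; simp [C]
      · exact ((hL x u (hCS u huC) v hvS hvu.1.symm).trans h).mono (by rw [Nat.succ_mul]; omega)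
    -- Three disjoint sets of edges: those inside `S x` touching `C` determine the cluster, `uv` is
    -- not inside `S x`, and the remaining connection avoids `C`.
    have hK : ∀ i ∈ T, ∀ C ∈ R i.1, μ.real (K i C) ≤ μ.real (B C) * (p * c ^ k) := by
      rintro ⟨u, v⟩ hi C hC
      simp only [T, R, Finset.mem_filter, Finset.mem_univ, true_and, Finset.mem_powerset] at hi hC
      have hB := dependsOnEdges_clusterIn G (S x : Set V) x C
      have h1 : μ.real (B C ∩ {X | s(u, v) ∈ X}) = μ.real (B C) * p := by
        rw [← setBernoulli_real_mem s(u, v) p]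
        refine hB.real_inter ?_ (dependsOnEdges_mem _) p
        simp only [Set.disjoint_singleton_right, Set.mem_ofPred_eq, not_and]
        intro h
        simp [hi.2.1] at h
      have h2 : μ.real (K (u, v) C) = μ.real (B C ∩ {X | s(u, v) ∈ X}) *
          μ.real (farIn G (C : Set V)ᶜ (k * L) v) := by
        refine DependsOnEdges.real_inter (F := {e | ∃ a ∈ e, a ∈ C}) (F' := (C : Set V)ᶜ.sym2)
          ?_ ?_ (dependsOnEdges_farIn G _ _ _) p
        · refine Set.disjoint_left.2 ?_
          rintro e ⟨a, ha, haC⟩ he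
          exact (Set.mem_sym2_iff_subset.1 he) ha haC
        · refine (hB.mono fun e he ↦ he.2).inter ((dependsOnEdges_mem _).mono ?_)
          rintro e rfl
          exact ⟨u, by simp, hC.2⟩
      rw [h2, h1, mul_assoc]
      refine mul_le_mul_of_nonneg_left (mul_le_mul_of_nonneg_left ?_ p.2.1) measureReal_nonneg
      refine (measureReal_mono ?_).trans (ih v)
      rintro X ⟨y, hy, hn⟩
      exact ⟨y, hy.mono (openIn_mono G (Set.subset_univ _) subset_rfl), hn⟩
    have hR : ∀ u, ∑ C ∈ R u, μ.real (B C) ≤ μ.real (connIn G (S x) x u) := by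
      intro u
      rw [← measureReal_biUnion_finset _ (fun S _ ↦ measurableSet_of_finite _)]
      · refine measureReal_mono (Set.iUnion₂_subset fun C hC X hX ↦ ?_)
        have : u ∈ {w | (openIn G (S x) X).Reachable x w} := by
          rw [show {w | (openIn G (S x) X).Reachable x w} = C from hX]
          simp only [R, Finset.mem_filter] at hC
          exact hC.2
        exact this
      · intro C _ C' _ hne
        exact Set.disjoint_left.2 fun X h h' ↦ hne (Finset.coe_injective (h.symm.trans h'))
    calc μ.real (farIn G Set.univ ((k + 1) * L) x)
        ≤ ∑ i ∈ T, μ.real (⋃ C ∈ R i.1, K i C) :=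
          (measureReal_mono hsub (measure_ne_top _ _)).trans (measureReal_biUnion_finset_le _ _)
      _ ≤ ∑ i ∈ T, μ.real (connIn G (S x) x i.1) * (p * c ^ k) := by
          refine Finset.sum_le_sum fun i hi ↦ ?_
          refine (measureReal_biUnion_finset_le _ _).trans
            ((Finset.sum_le_sum fun C hC ↦ hK i hi C hC).trans ?_)
          rw [← Finset.sum_mul]
          exact mul_le_mul_of_nonneg_right (hR i.1) (mul_nonneg p.2.1 hc)
      _ = phi G p (S x) x * c ^ k := by
          rw [← Finset.sum_mul, phi]
          have : ∑ i ∈ T, μ.real (connIn G (S x) x i.1) =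
              ∑ u ∈ S x, μ.real (connIn G (S x) x u) * {v | v ∉ S x ∧ G.Adj u v}.ncard := by
            simp only [T, Finset.sum_filter, Fintype.sum_prod_type]
            rw [← Finset.sum_subset (Finset.subset_univ (S x))]
            · refine Finset.sum_congr rfl fun u hu ↦ ?_
              simp only [hu, true_and]
              rw [← Finset.sum_filter, Finset.sum_const, nsmul_eq_mul, Set.ncard_eq_toFinset_card']
              simp only [Set.toFinset_ofPred]
              ring
            · intro u _ hu
              simp [hu]
          rw [this]
          ring
      _ ≤ c ^ (k + 1) := by
          rw [pow_succ']
          exact mul_le_mul_of_nonneg_right (hφ x) hc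

end Decay


/-! ### Neighbours and connectedness in the lattice -/

section Lattice

variable {R : Type} [Ring R] {d : ℕ}

lemma lattice_adj {x y : Fin d → R} : (lattice R d).Adj x y ↔
    x ≠ y ∧ ((∃ i, y = x + Pi.single i 1) ∨ ∃ i, x = y + Pi.single i 1) := by
  simp [lattice, SimpleGraph.fromRel_adj]

lemma lattice_adj_add_single [Nontrivial R] (x : Fin d → R) (i : Fin d) :
    (lattice R d).Adj x (x + Pi.single i 1) :=
  lattice_adj.2 ⟨by simp, .inl ⟨i, rfl⟩⟩

lemma lattice_neighbors_subset (x : Fin d → R) : {y | (lattice R d).Adj x y} ⊆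
    (fun e : Fin d × Bool ↦ if e.2 then x + Pi.single e.1 1 else x - Pi.single e.1 1) ''
      Set.univ := by
  intro y hy
  rcases (lattice_adj.1 hy).2 with ⟨i, rfl⟩ | ⟨i, rfl⟩
  · exact ⟨(i, true), trivial, by simp⟩
  · exact ⟨(i, false), trivial, by simp⟩

lemma finite_lattice_neighbors (x : Fin d → R) : {y | (lattice R d).Adj x y}.Finite :=
  (Set.finite_univ.image _).subset (lattice_neighbors_subset x)

lemma ncard_lattice_neighbors_le (x : Fin d → R) : {y | (lattice R d).Adj x y}.ncard ≤ 2 * d := by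
  refine (Set.ncard_le_ncard (lattice_neighbors_subset x) (Set.finite_univ.image _)).trans
    ((Set.ncard_image_le Set.finite_univ).trans ?_)
  simp [Set.ncard_univ, mul_comm]

lemma reachable_add_single (x : Fin d → ℤ) (i : Fin d) (k : ℤ) :
    (lattice ℤ d).Reachable x (x + Pi.single i k) := by
  induction k using Int.induction_on with
  | zero => simp
  | succ k ih =>
    refine ih.trans ?_
    rw [Pi.single_add, ← add_assoc]
    exact (lattice_adj_add_single _ i).reachable
  | pred k ih =>
    refine ih.trans ?_
    rw [Pi.single_sub, add_sub]
    have h := (lattice_adj_add_single (x + Pi.single i (-(k : ℤ)) - Pi.single i 1) i).symm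
    rw [sub_add_cancel] at h
    exact h.reachable

lemma lattice_int_reachable_zero (x : Fin d → ℤ) : (lattice ℤ d).Reachable 0 x := by
  classical
  have : ∀ s : Finset (Fin d), (lattice ℤ d).Reachable 0 (∑ i ∈ s, Pi.single i (x i)) := by
    intro s
    induction s using Finset.induction_on with
    | empty => simp
    | insert a s ha ih =>
      rw [Finset.sum_insert ha, add_comm]
      exact ih.trans (reachable_add_single _ _ _)
  simpa [Finset.univ_sum_single] using this Finset.univ

end Lattice

/-! ### A finite set with `φ < 1` below the critical probability -/

section Critical

variable {d : ℕ}

/-- The box `[-m, m] ^ d`. -/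
noncomputable def box (d m : ℕ) : Finset (Fin d → ℤ) := Finset.Icc (fun _ ↦ -(m : ℤ)) fun _ ↦ m

lemma mem_box {m : ℕ} {x : Fin d → ℤ} : x ∈ box d m ↔ ∀ i, |x i| ≤ m := by
  simp only [box, Finset.mem_Icc, Pi.le_def, abs_le, ← forall_and]

lemma box_mono {m k : ℕ} (h : m ≤ k) : box d m ⊆ box d k := fun x hx ↦
  mem_box.2 fun i ↦ (mem_box.1 hx i).trans (by exact_mod_cast h)

lemma exists_subset_box (S : Set (Fin d → ℤ)) (hS : S.Finite) : ∃ m, ∀ x ∈ S, x ∈ box d m := by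
  lift S to Finset (Fin d → ℤ) using hS
  refine ⟨S.sup fun x ↦ Finset.univ.sup fun i ↦ (x i).natAbs, fun x hx ↦ mem_box.2 fun i ↦ ?_⟩
  rw [Int.abs_eq_natAbs]
  have h1 : (x i).natAbs ≤ Finset.univ.sup fun i ↦ (x i).natAbs :=
    Finset.le_sup (f := fun i ↦ (x i).natAbs) (Finset.mem_univ i)
  have h2 := Finset.le_sup (f := fun x : Fin d → ℤ ↦ Finset.univ.sup fun i ↦ (x i).natAbs) hx
  exact_mod_cast h1.trans h2

lemma mem_box_succ_of_adj {m : ℕ} {x y : Fin d → ℤ} (hx : x ∈ box d m)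
    (h : (lattice ℤ d).Adj x y) : y ∈ box d (m + 1) := by
  rw [mem_box] at hx ⊢
  intro i
  have := hx i
  have hs : ∀ j, |(Pi.single j (1 : ℤ) : Fin d → ℤ) i| ≤ 1 := by
    intro j
    by_cases hij : i = j
    · subst hij; simp
    · simp [hij]
  push_cast
  rcases (lattice_adj.1 h).2 with ⟨j, rfl⟩ | ⟨j, rfl⟩
  · have := hs j
    simp only [Pi.add_apply, abs_le] at *
    omega
  · have := hs j
    simp only [Pi.add_apply, abs_le] at *
    omega

lemma openGraph_preimage {V : Type} (G : SimpleGraph V) (X : Set (Sym2 V)) :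
    openGraph G (Subtype.val ⁻¹' X) = openIn G Set.univ X := by
  ext a b
  simp only [openGraph, SimpleGraph.fromEdgeSet_adj, openIn]
  constructor
  · rintro ⟨⟨e, he, hab⟩, hne⟩
    have := e.2
    rw [hab] at this
    exact ⟨this, hab ▸ he, trivial, trivial⟩
  · rintro ⟨h1, h2, -⟩
    exact ⟨⟨⟨s(a, b), h1⟩, h2, rfl⟩, h1.ne⟩

/-- Below the critical probability, `φ(S) < 1` for some finite set `S`. -/
theorem exists_phi_lt_one {s : I} (hs : s < pPerc d) :
    ∃ S : Finset (Fin d → ℤ), 0 ∈ S ∧ phi (lattice ℤ d) s S 0 < 1 := by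
  classical
  by_contra! hcon
  obtain ⟨s', hs', hlt⟩ := lt_sSup_iff.1 hs
  rw [Set.mem_ofPred_eq] at hs'
  set G := lattice ℤ d with hG
  have hval : Measurable fun X : Set (Sym2 (Fin d → ℤ)) ↦
      (Subtype.val ⁻¹' X : Set G.edgeSet) := measurable_set_iff.2 fun a ↦ measurable_set_mem _
  rw [← map_preimage_setBernoulli (Subtype.val_injective (p := fun e ↦ e ∈ G.edgeSet)) s'] at hs'
  have hfin : ∀ᵐ X ∂(setBernoulli Set.univ s' : Measure (Set (Sym2 (Fin d → ℤ)))),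
      {v | (openIn G Set.univ X).Reachable 0 v}.Finite := by
    filter_upwards [ae_of_ae_map hval.aemeasurable hs'] with X hX
    rw [← openGraph_preimage]
    exact hX
  set μ : Measure (Set (Sym2 (Fin d → ℤ))) := setBernoulli Set.univ s' with hμ
  set δ : ℝ := 1 - Real.exp (-((s' : ℝ) - s)) with hδ
  have hδ0 : 0 < δ := by
    have : (s : ℝ) < s' := hlt
    rw [hδ, sub_pos, Real.exp_lt_one_iff]
    linarith
  -- The target is the layer of `box d (m + 1)` outside `box d m`, so a set avoiding it has all its
  -- lattice neighbours inside the finite graph and the same `φ` as in `ℤ ^ d`.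
  let A : ℕ → Set (Set (Sym2 (Fin d → ℤ))) := fun m ↦
    {X | Sym2.map (Subtype.val : box d (m + 1) → _) ⁻¹' X ∈ connTo
      (G.comap (Subtype.val : box d (m + 1) → _)) {w | (w : Fin d → ℤ) ∉ box d m}
      ⟨0, mem_box.2 fun i ↦ by simp; positivity⟩}
  have hAm : ∀ m, MeasurableSet (A m) := fun m ↦
    (measurable_set_iff.2 fun a ↦ measurable_set_mem _ : Measurable
      fun X : Set (Sym2 (Fin d → ℤ)) ↦ Sym2.map (Subtype.val : box d (m + 1) → _) ⁻¹' X)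
      (measurableSet_of_finite _)
  have hA : ∀ m, δ ≤ μ.real (A m) := by
    intro m
    rw [hμ, setBernoulli_preimage (Sym2.map.injective Subtype.val_injective) s'
      (measurableSet_of_finite _)]
    refine one_sub_exp_le_real_connTo _ _ hlt.le _ fun S ho hSD ↦ ?_
    have h0 : (0 : Fin d → ℤ) ∈ S.image Subtype.val := Finset.mem_image.2 ⟨_, ho, rfl⟩
    refine (hcon _ h0).trans (le_of_eq ?_)
    unfold phi
    rw [Finset.sum_image Subtype.val_injective.injOn]
    congr 1
    refine Finset.sum_congr rfl fun u hu ↦ ?_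
    congr 1
    · rw [Finset.coe_image]
      exact real_connIn_image (f := Subtype.val) Subtype.val_injective.injOn
        (fun _ _ _ _ ↦ Iff.rfl) s ho hu
    · have hum : (u : Fin d → ℤ) ∈ box d m := by
        by_contra h
        exact Set.disjoint_left.1 hSD hu h
      rw [← Set.ncard_image_of_injective _ Subtype.val_injective]
      congr 2
      ext v
      constructor
      · rintro ⟨h1, h2⟩
        exact ⟨⟨v, mem_box_succ_of_adj hum h2⟩, ⟨fun h ↦ h1 (Finset.mem_image_of_mem _ h), h2⟩, rfl⟩
      · rintro ⟨v, ⟨h1, h2⟩, rfl⟩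
        refine ⟨fun h ↦ h1 ?_, h2⟩
        obtain ⟨w, hw, hwv⟩ := Finset.mem_image.1 h
        rwa [← Subtype.ext hwv]
  have hAsub : ∀ m X, X ∈ A m → ∃ y ∉ box d m, (openIn G Set.univ X).Reachable 0 y := by
    rintro m X ⟨z, hz, hr⟩
    refine ⟨z, hz, ?_⟩
    rw [← reachable_openIn_range_iff Subtype.val_injective (G := G) (fun _ _ ↦ Iff.rfl)] at hr
    exact hr.mono (openIn_mono G (Set.subset_univ _) subset_rfl)
  -- Monotonicity of `A m` in `m` is not needed: their upper limit has probability at least `δ`, and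
  -- on it the cluster of the origin is infinite.
  have hanti : Antitone fun n ↦ ⋃ m ≥ n, A m := fun n n' h ↦
    Set.biUnion_subset_biUnion_left fun m (hm : n' ≤ m) ↦ h.trans hm
  have hlim := tendsto_measure_iInter_atTop (μ := μ) (s := fun n ↦ ⋃ m ≥ n, A m)
    (fun n ↦ (MeasurableSet.biUnion (Set.to_countable _) fun m _ ↦ hAm m).nullMeasurableSet)
    hanti ⟨0, measure_ne_top _ _⟩
  have hzero : μ (⋂ n, ⋃ m ≥ n, A m) = 0 := by
    refine measure_mono_null ?_ hfin
    intro X hX hXfin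
    obtain ⟨n, hn⟩ := exists_subset_box _ hXfin
    simp only [Set.mem_iInter, Set.mem_iUnion] at hX
    obtain ⟨m, hm, hXm⟩ := hX n
    obtain ⟨y, hy, hr⟩ := hAsub m X hXm
    exact hy (box_mono hm (hn y hr))
  rw [hzero] at hlim
  have hge : ∀ n, ENNReal.ofReal δ ≤ μ (⋃ m ≥ n, A m) := fun n ↦ by
    refine le_trans ?_ (measure_mono (Set.subset_biUnion_of_mem (le_refl n)))
    rw [← ofReal_measureReal]
    exact ENNReal.ofReal_le_ofReal (hA n)
  have := ge_of_tendsto' hlim hge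
  simp only [nonpos_iff_eq_zero, ENNReal.ofReal_eq_zero] at this
  linarith

lemma phi_singleton_le (s : I) : phi (lattice ℤ d) s {0} 0 ≤ s * (2 * d) := by
  unfold phi
  refine mul_le_mul_of_nonneg_left ?_ s.2.1
  rw [Finset.sum_singleton]
  have h1 : ({v | v ∉ ({0} : Finset (Fin d → ℤ)) ∧ (lattice ℤ d).Adj 0 v}.ncard : ℝ) ≤ 2 * d := by
    exact_mod_cast (Set.ncard_le_ncard (s := {v | v ∉ ({0} : Finset (Fin d → ℤ)) ∧ (lattice ℤ d).Adj 0 v})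
      (fun v hv ↦ hv.2) (finite_lattice_neighbors 0)).trans
      (ncard_lattice_neighbors_le (0 : Fin d → ℤ))
  exact (mul_le_of_le_one_left (by positivity) measureReal_le_one).trans h1

end Critical

/-! ### Transfer of the decay to large tori -/

section Torus

variable {d n : ℕ}

/-- The covering map of the torus, sending the origin to `x`. -/
def cover (x : Fin d → ZMod n) (u : Fin d → ℤ) : Fin d → ZMod n := fun i ↦ x i + u i

lemma cover_zero (x : Fin d → ZMod n) : cover x 0 = x := by ext; simp [cover]

lemma cover_add_single (x : Fin d → ZMod n) (u : Fin d → ℤ) (i : Fin d) :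
    cover x (u + Pi.single i 1) = cover x u + Pi.single i 1 := by
  ext j
  by_cases h : j = i
  · subst h; simp [cover, add_assoc]
  · simp [cover, h]

lemma cover_adj [Fact (1 < n)] (x : Fin d → ZMod n) {u v : Fin d → ℤ}
    (h : (lattice ℤ d).Adj u v) : (torus d n).Adj (cover x u) (cover x v) := by
  rcases (lattice_adj.1 h).2 with ⟨i, rfl⟩ | ⟨i, rfl⟩
  · rw [cover_add_single]; exact lattice_adj_add_single _ _
  · rw [cover_add_single]; exact (lattice_adj_add_single _ _).symm

lemma eq_of_cover_eq {x : Fin d → ZMod n} {u v : Fin d → ℤ} {M : ℕ} (hu : u ∈ box d M)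
    (hv : v ∈ box d M) (hn : 2 * M < n) (h : cover x u = cover x v) : u = v := by
  ext i
  have h1 : ((u i : ℤ) : ZMod n) = v i := add_left_cancel (congrFun h i)
  rw [ZMod.intCast_eq_intCast_iff_dvd_sub] at h1
  have h2 := abs_le.1 (mem_box.1 hu i)
  have h3 := abs_le.1 (mem_box.1 hv i)
  have := Int.eq_zero_of_abs_lt_dvd h1 (by rw [abs_lt]; omega)
  omega

lemma exists_of_torus_adj [Fact (1 < n)] {x : Fin d → ZMod n} {u : Fin d → ℤ} {w : Fin d → ZMod n}
    (h : (torus d n).Adj (cover x u) w) : ∃ v, cover x v = w ∧ (lattice ℤ d).Adj u v := by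
  rcases (lattice_adj.1 h).2 with ⟨i, rfl⟩ | ⟨i, hi⟩
  · exact ⟨u + Pi.single i 1, cover_add_single x u i, lattice_adj_add_single u i⟩
  · refine ⟨u - Pi.single i 1, ?_, ?_⟩
    · have := cover_add_single x (u - Pi.single i 1) i
      rw [sub_add_cancel, hi] at this
      exact (add_right_cancel this).symm
    · have h := (lattice_adj_add_single (u - Pi.single i 1) i).symm
      rwa [sub_add_cancel] at h

lemma Near.cover [Fact (1 < n)] (x : Fin d → ZMod n) {m : ℕ} {u v : Fin d → ℤ}
    (h : Near (lattice ℤ d) m u v) : Near (torus d n) m (cover x u) (cover x v) := by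
  obtain ⟨w, hw⟩ := h
  let f : lattice ℤ d →g torus d n := ⟨FK.cover x, fun h ↦ cover_adj x h⟩
  exact ⟨w.map f, by simpa using hw⟩

/-- Exponential decay on large tori. -/
theorem exists_torus_decay {s : I} {S : Finset (Fin d → ℤ)} (h0 : 0 ∈ S) :
    ∃ L N : ℕ, ∀ n, N ≤ n → ∀ k (x : Fin d → ZMod n),
      (setBernoulli Set.univ s).real (farIn (torus d n) Set.univ (k * L) x) ≤
        phi (lattice ℤ d) s S 0 ^ k := by
  classical
  have hL : ∃ L, ∀ u ∈ S, Near (lattice ℤ d) L 0 u := by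
    let w : ∀ u : Fin d → ℤ, (lattice ℤ d).Walk 0 u := fun u ↦
      (lattice_int_reachable_zero u).some
    exact ⟨S.sup fun u ↦ (w u).length, fun u hu ↦ ⟨w u, Finset.le_sup (f := fun u ↦ (w u).length) hu⟩⟩
  obtain ⟨L, hL⟩ := hL
  obtain ⟨M, hM⟩ := exists_subset_box (S : Set (Fin d → ℤ)) S.finite_toSet
  -- The extra `1` in `L + 1` is the step out of `S`. The box of radius `M + 1` contains `S` and its
  -- neighbours, and the covering map is injective on it once `n > 2 * (M + 1)`.
  refine ⟨L + 1, 2 * (M + 1) + 2, fun n hn k x ↦ ?_⟩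
  have : Fact (1 < n) := ⟨by omega⟩
  have : NeZero n := ⟨by omega⟩
  have hinj : ∀ x : Fin d → ZMod n, Set.InjOn (cover x) S := fun x u hu v hv h ↦
    eq_of_cover_eq (hM u hu) (hM v hv) (by omega) h
  refine real_farIn_le_pow (torus d n) (fun x ↦ S.image (cover x)) (L := L + 1) ?_ ?_ ?_ ?_ k x
  · exact fun x ↦ Finset.mem_image.2 ⟨0, h0, cover_zero x⟩
  · intro x u hu
    obtain ⟨u, huS, rfl⟩ := Finset.mem_image.1 hu
    have := (hL u huS).cover x
    rw [cover_zero] at this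
    exact this.mono (Nat.le_succ L)
  · intro x u hu v _ huv
    obtain ⟨u, huS, rfl⟩ := Finset.mem_image.1 hu
    have := (hL u huS).cover x
    rw [cover_zero] at this
    exact this.trans ⟨huv.toWalk, by simp⟩
  · intro x
    unfold phi
    refine mul_le_mul_of_nonneg_left ?_ s.2.1
    rw [Finset.sum_image (hinj x)]
    refine Finset.sum_le_sum fun u hu ↦ ?_
    have hadj : ∀ u ∈ S, ∀ v ∈ S, (torus d n).Adj (cover x u) (cover x v) ↔
        (lattice ℤ d).Adj u v := by
      refine fun u hu v hv ↦ ⟨fun h ↦ ?_, cover_adj x⟩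
      obtain ⟨v', hv', h'⟩ := exists_of_torus_adj h
      rwa [← eq_of_cover_eq (mem_box_succ_of_adj (hM u hu) h') (box_mono (Nat.le_succ M) (hM v hv))
        (by omega) hv']
    have hconn := real_connIn_image (hinj x) hadj s h0 hu
    rw [cover_zero] at hconn
    rw [Finset.coe_image, hconn]
    refine mul_le_mul_of_nonneg_left ?_ measureReal_nonneg
    have hfin : {v | v ∉ S ∧ (lattice ℤ d).Adj u v}.Finite :=
      (finite_lattice_neighbors u).subset fun v hv ↦ hv.2
    refine Nat.cast_le.2 ((Set.ncard_le_ncard ?_ (hfin.image (cover x))).trans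
      (Set.ncard_image_le hfin))
    rintro w ⟨hw, h⟩
    obtain ⟨v, rfl, hv⟩ := exists_of_torus_adj h
    exact ⟨v, ⟨fun hvS ↦ hw (Finset.mem_image_of_mem _ hvS), hv⟩, rfl⟩

/-- For small `p` there is exponential decay on large tori at a parameter larger than both `p`
and `p_init`. -/
theorem exists_decay (hd : 0 < d) : ∃ p₀ : ℝ, 0 < p₀ ∧ ∀ p : I, (p : ℝ) < p₀ →
    ∃ s : I, p < s ∧ pInit d p < s ∧ ∃ c : ℝ, 0 < c ∧ c < 1 ∧ ∃ L N : ℕ, ∀ n, N ≤ n →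
      ∀ k (x : Fin d → ZMod n),
        (setBernoulli Set.univ s).real (farIn (torus d n) Set.univ (k * L) x) ≤ c ^ k := by
  have hd' : (1 : ℝ) ≤ d := by exact_mod_cast hd
  have key : ∃ p₀ : ℝ, 0 < p₀ ∧ ∀ p : I, (p : ℝ) < p₀ → ∃ s : I, p < s ∧ pInit d p < s ∧
      ∃ S : Finset (Fin d → ℤ), 0 ∈ S ∧ phi (lattice ℤ d) s S 0 < 1 := by
    -- If `pPerc d = 0` then `pInit` is `p / 2`, and the parameter `1 / (4 * d)` gives `φ ≤ 1 / 2`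
    -- for a single vertex.
    by_cases h : pPerc d = 0
    · refine ⟨1 / (4 * d), by positivity, fun p hp ↦ ?_⟩
      have h1 : 1 / (4 * (d : ℝ)) ≤ 1 := by
        rw [div_le_one (by positivity)]; linarith
      refine ⟨⟨1 / (4 * d), by positivity, h1⟩, hp, ?_, {0}, by simp, ?_⟩
      · change ((p : ℝ) + pPerc d) / 2 < 1 / (4 * d)
        rw [h]
        have := p.2.1
        simp only [Set.Icc.coe_zero]
        linarith
      · refine (phi_singleton_le _).trans_lt ?_
        change 1 / (4 * (d : ℝ)) * (2 * d) < 1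
        field_simp
        norm_num
    · refine ⟨pPerc d, (unitInterval.pos_iff_ne_zero).2 h, fun p hp ↦ ?_⟩
      have h1 : pInit d p < pPerc d := by
        change ((p : ℝ) + pPerc d) / 2 < pPerc d
        linarith
      obtain ⟨s, hs, hs'⟩ := exists_between (max_lt (show p < pPerc d from hp) h1)
      exact ⟨s, (le_max_left _ _).trans_lt hs, (le_max_right _ _).trans_lt hs,
        exists_phi_lt_one hs'⟩
  obtain ⟨p₀, hp₀, H⟩ := key
  refine ⟨p₀, hp₀, fun p hp ↦ ?_⟩
  obtain ⟨s, h1, h2, S, hS, hφ⟩ := H p hp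
  -- The maximum with `1 / 2` keeps the rate positive, as its logarithm is taken later.
  refine ⟨s, h1, h2, max (phi (lattice ℤ d) s S 0) (1 / 2), by positivity,
    max_lt hφ (by norm_num), ?_⟩
  obtain ⟨L, N, hLN⟩ := exists_torus_decay (s := s) hS
  refine ⟨L, N, fun n hn k x ↦ (hLN n hn k x).trans (pow_le_pow_left₀ ?_ (le_max_left _ _) k)⟩
  exact mul_nonneg s.2.1 (Finset.sum_nonneg fun u _ ↦ by positivity)

end Torus

open scoped ENNReal


/-! ### Exponential waiting times and independent marks -/

section Exponential

instance : IsProbabilityMeasure (expMeasure 1) := isProbabilityMeasure_expMeasure one_pos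

lemma expMeasure_Iic_zero : expMeasure 1 (Set.Iic 0) = 0 := by
  rw [← ofReal_cdf, cdf_expMeasure_eq one_pos]
  simp

lemma expMeasure_real_Iic {x : ℝ} (hx : 0 ≤ x) :
    (expMeasure 1).real (Set.Iic x) = 1 - Real.exp (-x) := by
  rw [← ProbabilityTheory.cdf_eq_real, cdf_expMeasure_eq one_pos, if_pos hx, one_mul]

lemma expMeasure_real_Ioi {x : ℝ} (hx : 0 ≤ x) :
    (expMeasure 1).real (Set.Ioi x) = Real.exp (-x) := by
  rw [← Set.compl_Iic, probReal_compl_eq_one_sub measurableSet_Iic, expMeasure_real_Iic hx]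
  ring

/-- The hazard rate of the exponential distribution of mean `1` is `1`. -/
lemma expMeasure_Ioc_le {x h : ℝ} (hx : 0 ≤ x) (hh : 0 ≤ h) :
    expMeasure 1 (Set.Ioc x (x + h)) ≤ ENNReal.ofReal h * expMeasure 1 (Set.Ioi x) := by
  have h1 : (expMeasure 1).real (Set.Ioc x (x + h)) = Real.exp (-x) * (1 - Real.exp (-h)) := by
    rw [← Set.Iic_sdiff_Iic, measureReal_sdiff (Set.Iic_subset_Iic.2 (by linarith))
      measurableSet_Iic, expMeasure_real_Iic hx, expMeasure_real_Iic (by linarith), neg_add,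
      Real.exp_add]
    ring
  rw [← ofReal_measureReal, ← ofReal_measureReal, ← ENNReal.ofReal_mul hh, h1,
    expMeasure_real_Ioi hx]
  apply ENNReal.ofReal_le_ofReal
  have := Real.add_one_le_exp (-h)
  nlinarith [Real.exp_pos (-x)]

end Exponential

section Independence

lemma indepFun_update_infinitePi {α : Type*} [MeasurableSpace α] (μ : ℕ → Measure α)
    [∀ i, IsProbabilityMeasure (μ i)] (k : ℕ) (a : α) :
    IndepFun (fun w : ℕ → α ↦ Function.update w k a) (fun w ↦ w k) (Measure.infinitePi μ) := by
  have h : iIndepFun (fun (i : ℕ) (w : ℕ → α) ↦ w i) (Measure.infinitePi μ) :=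
    iIndepFun_infinitePi (X := fun _ x ↦ x) (by fun_prop)
  have h2 := indep_iSup_of_disjoint (fun i ↦ (measurable_pi_apply i).comap_le) h.iIndep
    (S := {k}ᶜ) (T := {k}) disjoint_compl_left
  refine indep_of_indep_of_le_left (indep_of_indep_of_le_right h2 ?_) ?_
  · exact le_iSup₂_of_le k rfl le_rfl
  · rw [← measurable_iff_comap_le]
    refine @measurable_pi_lambda _ _ _ (_) _ _ fun i ↦ ?_
    by_cases hi : i = k
    · subst hi
      simp only [Function.update_self]
      exact @measurable_const _ _ _ (_) _
    · simp only [Function.update_of_ne hi]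
      rw [measurable_iff_comap_le]
      exact le_iSup₂_of_le i hi le_rfl

variable {Ω α : Type*} [MeasurableSpace Ω] [MeasurableSpace α] {κ : Measure Ω}
  [IsProbabilityMeasure κ]

lemma measure_inter_snd {R : Ω → α} {Y : Ω → ℝ × I} (hR : Measurable R) (hY : Measurable Y)
    (hi : IndepFun R Y κ) {μ₁ : Measure ℝ} [IsProbabilityMeasure μ₁] {μ₂ : Measure I}
    [IsProbabilityMeasure μ₂] (hmap : κ.map Y = μ₁.prod μ₂) {Q : Set (α × ℝ)}
    (hQ : MeasurableSet Q) {U : Set I} (hU : MeasurableSet U) :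
    κ {ω | (R ω, (Y ω).1) ∈ Q ∧ (Y ω).2 ∈ U} = κ {ω | (R ω, (Y ω).1) ∈ Q} * μ₂ U := by
  have hprob : IsProbabilityMeasure (κ.map R) := Measure.isProbabilityMeasure_map hR.aemeasurable
  have hm := (indepFun_iff_map_prod_eq_prod_map_map hR.aemeasurable hY.aemeasurable).1 hi
  rw [hmap, ← (measurePreserving_prodAssoc (κ.map R) μ₁ μ₂).map_eq] at hm
  have key : ∀ U' : Set I, MeasurableSet U' →
      κ {ω | (R ω, (Y ω).1) ∈ Q ∧ (Y ω).2 ∈ U'} = ((κ.map R).prod μ₁) Q * μ₂ U' := by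
    intro U' hU'
    have hms : MeasurableSet {y : α × ℝ × I | (y.1, y.2.1) ∈ Q ∧ y.2.2 ∈ U'} :=
      (hQ.preimage (by fun_prop : Measurable fun y : α × ℝ × I ↦ (y.1, y.2.1))).inter
        (hU'.preimage (by fun_prop))
    have := congrArg (fun m ↦ m {y : α × ℝ × I | (y.1, y.2.1) ∈ Q ∧ y.2.2 ∈ U'}) hm
    rw [Measure.map_apply (hR.prodMk hY) hms, Measure.map_apply (by fun_prop) hms] at this
    refine (this : _).trans ?_
    rw [← Measure.prod_prod]
    rfl
  have h1 := key Set.univ MeasurableSet.univ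
  simp only [Set.mem_univ, and_true, measure_univ, mul_one] at h1
  rw [key U hU, h1]

/-- Condition on `R`: on `P` the clock `S` has not passed `a`, so the hazard rate bound applies to
the waiting time at `a - S ≥ 0`. -/
lemma measure_exp_Ioc_le {R : Ω → α} {Y : Ω → ℝ × I} (hR : Measurable R) (hY : Measurable Y)
    (hi : IndepFun R Y κ) {μ₂ : Measure I} [IsProbabilityMeasure μ₂]
    (hmap : κ.map Y = (expMeasure 1).prod μ₂) {P : Set α} (hP : MeasurableSet P) {S : α → ℝ}
    (hS : Measurable S) {a b : ℝ} (hab : a ≤ b) (hPS : ∀ r ∈ P, S r ≤ a) :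
    κ {ω | R ω ∈ P ∧ a < S (R ω) + (Y ω).1 ∧ S (R ω) + (Y ω).1 ≤ b} ≤
      ENNReal.ofReal (b - a) * κ {ω | R ω ∈ P ∧ a < S (R ω) + (Y ω).1} := by
  have hprob : IsProbabilityMeasure (κ.map R) := Measure.isProbabilityMeasure_map hR.aemeasurable
  have hY1 : κ.map (fun ω ↦ (Y ω).1) = expMeasure 1 := by
    have : κ.map (fun ω ↦ (Y ω).1) = (κ.map Y).map Prod.fst :=
      (Measure.map_map measurable_fst hY).symm
    rw [this, hmap, Measure.map_fst_prod]
    simp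
  have hm := (indepFun_iff_map_prod_eq_prod_map_map hR.aemeasurable
    (measurable_fst.comp hY).aemeasurable).1 (hi.comp measurable_id measurable_fst)
  change κ.map (fun ω ↦ (R ω, (Y ω).1)) = (κ.map R).prod (κ.map (fun ω ↦ (Y ω).1)) at hm
  rw [hY1] at hm
  have hms1 : MeasurableSet {y : α × ℝ | y.1 ∈ P ∧ a < S y.1 + y.2} :=
    (hP.preimage measurable_fst).inter
      (measurableSet_lt (g := fun y : α × ℝ ↦ S y.1 + y.2) (by fun_prop) (by fun_prop))
  have hms2 : MeasurableSet {y : α × ℝ | y.1 ∈ P ∧ a < S y.1 + y.2 ∧ S y.1 + y.2 ≤ b} :=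
    (hP.preimage measurable_fst).inter 
      ((measurableSet_lt (g := fun y : α × ℝ ↦ S y.1 + y.2) (by fun_prop) (by fun_prop)).inter
      (measurableSet_le (f := fun y : α × ℝ ↦ S y.1 + y.2) (by fun_prop) (by fun_prop)))
  have e1 := congrArg (fun m ↦ m {y : α × ℝ | y.1 ∈ P ∧ a < S y.1 + y.2}) hm
  have e2 := congrArg (fun m ↦ m {y : α × ℝ | y.1 ∈ P ∧ a < S y.1 + y.2 ∧ S y.1 + y.2 ≤ b}) hm
  rw [Measure.map_apply (hR.prodMk hY.fst) hms1] at e1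
  rw [Measure.map_apply (hR.prodMk hY.fst) hms2] at e2
  refine (e2 : κ _ = _).trans_le (le_of_le_of_eq ?_ (congrArg _ (e1 : κ _ = _)).symm)
  rw [Measure.prod_apply hms1, Measure.prod_apply hms2, ← lintegral_const_mul _
    (measurable_measure_prodMk_left hms1)]
  refine lintegral_mono fun r ↦ ?_
  by_cases hr : r ∈ P
  · have s1 : Prod.mk r ⁻¹' {y : α × ℝ | y.1 ∈ P ∧ a < S y.1 + y.2} = Set.Ioi (a - S r) := by
      ext x
      simp only [Set.mem_preimage, Set.mem_ofPred_eq, hr, true_and, Set.mem_Ioi]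
      constructor <;> intro h <;> linarith
    have s2 : Prod.mk r ⁻¹' {y : α × ℝ | y.1 ∈ P ∧ a < S y.1 + y.2 ∧ S y.1 + y.2 ≤ b} =
        Set.Ioc (a - S r) (a - S r + (b - a)) := by
      ext x
      simp only [Set.mem_preimage, Set.mem_ofPred_eq, hr, true_and, Set.mem_Ioc]
      constructor <;> rintro ⟨h, h'⟩ <;> constructor <;> linarith
    change expMeasure 1 (Prod.mk r ⁻¹' _) ≤ _ * expMeasure 1 (Prod.mk r ⁻¹' _)
    rw [s1, s2]
    exact expMeasure_Ioc_le (by linarith [hPS r hr]) (by linarith)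
  · have s2 : Prod.mk r ⁻¹' {y : α × ℝ | y.1 ∈ P ∧ a < S y.1 + y.2 ∧ S y.1 + y.2 ≤ b} = ∅ := by
      ext x
      simp [hr]
    change expMeasure 1 (Prod.mk r ⁻¹' _) ≤ _
    rw [s2, measure_empty]
    exact zero_le

end Independence

/-! ### The updates of one edge around a time slab -/

section Renewal

/-- The time of the `k`-th update of an edge, given its sequence of waiting times and marks. -/
noncomputable def arrival (w : ℕ → ℝ × I) (k : ℕ) : ℝ := ∑ j ∈ Finset.range k, (w j).1

@[fun_prop]
lemma measurable_arrival (k : ℕ) : Measurable fun w : ℕ → ℝ × I ↦ arrival w k := by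
  unfold arrival
  fun_prop

/-- There are `k` updates up to time `a`. -/
def CountEq (a : ℝ) (k : ℕ) (w : ℕ → ℝ × I) : Prop :=
  (∀ i ≤ k, arrival w i ≤ a) ∧ a < arrival w (k + 1)

lemma measurableSet_countEq (a : ℝ) (k : ℕ) : MeasurableSet {w | CountEq a k w} := by
  unfold CountEq
  measurability

/-- Since `CountEq` constrains every `i ≤ k`, no positivity of the waiting times is required. -/
lemma disjoint_countEq {a : ℝ} {k k' : ℕ} (h : k ≠ k') :
    Disjoint {w | CountEq a k w} {w | CountEq a k' w} := by
  rw [Set.disjoint_left]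
  rintro w ⟨h1, h2⟩ ⟨h1', h2'⟩
  rcases lt_or_gt_of_ne h with h | h
  · exact absurd h2 (not_lt.2 (h1' _ h))
  · exact absurd h2' (not_lt.2 (h1 _ h))

/-- An edge which is initially open if `z`, and which opens at its updates with a mark at least
`1 - p`, may be open at some time of `(a, b]`, the updates during `(a, b]` being disregarded. -/
def SlabOpen (p : I) (a b : ℝ) (z : Prop) (w : ℕ → ℝ × I) : Prop :=
  (z ∧ CountEq a 0 w) ∨ (∃ k, CountEq a (k + 1) w ∧ σ p ≤ (w k).2) ∨
    ∃ k, CountEq a k w ∧ arrival w (k + 1) ≤ b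

lemma measurableSet_slabOpen (p : I) (a b : ℝ) (z : Prop) :
    MeasurableSet {w | SlabOpen p a b z w} := by
  have h1 := measurableSet_countEq a
  have h2 : ∀ k, MeasurableSet {w : ℕ → ℝ × I | σ p ≤ (w k).2} := fun k ↦
    measurableSet_le measurable_const (by fun_prop)
  have h3 : ∀ k, MeasurableSet {w : ℕ → ℝ × I | arrival w (k + 1) ≤ b} := fun k ↦
    measurableSet_le (by fun_prop) measurable_const
  have : {w | SlabOpen p a b z w} = ({w | z ∧ CountEq a 0 w}) ∪
      ((⋃ k, {w | CountEq a (k + 1) w} ∩ {w | σ p ≤ (w k).2}) ∪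
        ⋃ k, {w | CountEq a k w} ∩ {w | arrival w (k + 1) ≤ b}) := by
    ext w
    simp [SlabOpen]
  rw [this]
  refine MeasurableSet.union ?_ ((MeasurableSet.iUnion fun k ↦ (h1 _).inter (h2 k)).union
    (MeasurableSet.iUnion fun k ↦ (h1 _).inter (h3 k)))
  exact (MeasurableSet.const z).inter (h1 0)

/-- The law of the updates of one edge. -/
noncomputable def edgeLaw : Measure (ℕ → ℝ × I) :=
  Measure.infinitePi fun _ ↦ (expMeasure 1).prod (volume : Measure I)

instance : IsProbabilityMeasure edgeLaw := by unfold edgeLaw; infer_instance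

lemma edgeLaw_map_eval (k : ℕ) :
    edgeLaw.map (fun w ↦ w k) = (expMeasure 1).prod (volume : Measure I) :=
  Measure.infinitePi_map_eval _ k

lemma arrival_congr {w w' : ℕ → ℝ × I} {k : ℕ} (h : ∀ j < k, (w j).1 = (w' j).1) :
    arrival w k = arrival w' k :=
  Finset.sum_congr rfl fun j hj ↦ h j (Finset.mem_range.1 hj)

lemma edgeLaw_countEq_mark (p : I) (a : ℝ) (k m : ℕ) :
    edgeLaw {w | CountEq a m w ∧ σ p ≤ (w k).2} =
      edgeLaw {w | CountEq a m w} * ENNReal.ofReal p := by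
  -- The count is recovered from the sequence with slot `k` erased together with the waiting time of
  -- slot `k`; both are independent of the mark in that slot.
  have h := measure_inter_snd (κ := edgeLaw) (R := fun w ↦ Function.update w k 0)
    (Y := fun w ↦ w k) (measurable_pi_lambda _ fun i ↦ by
      by_cases hi : i = k
      · subst hi; simp
      · simp only [Function.update_of_ne hi]; fun_prop) (by fun_prop)
    (indepFun_update_infinitePi _ k 0) (edgeLaw_map_eval k)
    (Q := {y | CountEq a m (Function.update y.1 k (y.2, 0))})
    ((measurableSet_countEq a m).preimage (measurable_pi_lambda _ fun i ↦ by
      by_cases hi : i = k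
      · subst hi; simp only [Function.update_self]; fun_prop
      · simp only [Function.update_of_ne hi]; fun_prop))
    (U := Set.Ici (σ p)) measurableSet_Ici
  have hc : ∀ w : ℕ → ℝ × I, CountEq a m
      (Function.update (Function.update w k 0) k ((w k).1, 0)) ↔ CountEq a m w := by
    intro w
    have : ∀ i, arrival (Function.update (Function.update w k 0) k ((w k).1, 0)) i =
        arrival w i := fun i ↦ arrival_congr fun j _ ↦ by
      by_cases hj : j = k
      · subst hj; simp
      · simp [hj]
    simp only [CountEq, this]
  simp only [Set.mem_ofPred_eq, hc, Set.mem_Ici] at h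
  rw [h, unitInterval.volume_Ici]
  simp

lemma edgeLaw_countEq_next_le {a b : ℝ} (hab : a ≤ b) (k : ℕ) :
    edgeLaw {w | CountEq a k w ∧ arrival w (k + 1) ≤ b} ≤
      ENNReal.ofReal (b - a) * edgeLaw {w | CountEq a k w} := by
  have hmeas : Measurable fun w : ℕ → ℝ × I ↦ Function.update w k 0 :=
    measurable_pi_lambda _ fun i ↦ by
      by_cases hi : i = k
      · subst hi; simp
      · simp only [Function.update_of_ne hi]; fun_prop
  have h := measure_exp_Ioc_le (κ := edgeLaw) (R := fun w ↦ Function.update w k 0)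
    (Y := fun w ↦ w k) hmeas (by fun_prop)
    (indepFun_update_infinitePi _ k 0) (edgeLaw_map_eval k)
    (P := {v | ∀ i ≤ k, arrival v i ≤ a}) (by measurability) (S := fun v ↦ arrival v k)
    (by fun_prop) hab (fun r hr ↦ hr k le_rfl)
  have hS : ∀ w : ℕ → ℝ × I, ∀ i ≤ k, arrival (Function.update w k 0) i = arrival w i :=
    fun w i hi ↦ arrival_congr fun j hj ↦ by rw [Function.update_of_ne (by omega)]
  have hsucc : ∀ w : ℕ → ℝ × I, arrival w k + (w k).1 = arrival w (k + 1) := fun w ↦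
    (Finset.sum_range_succ _ _).symm
  have hP : ∀ w : ℕ → ℝ × I, (∀ i ≤ k, arrival (Function.update w k 0) i ≤ a) ↔
      ∀ i ≤ k, arrival w i ≤ a := fun w ↦
    forall₂_congr fun i hi ↦ by rw [hS w i hi]
  simp only [Set.mem_ofPred_eq, hP, hS _ k le_rfl, hsucc, ← and_assoc] at h
  exact h

lemma tsum_edgeLaw_countEq_le (a : ℝ) : ∑' k, edgeLaw {w | CountEq a k w} ≤ 1 := by
  rw [← measure_iUnion (fun k k' h ↦ disjoint_countEq h) (measurableSet_countEq a)]
  exact prob_le_one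

/-- The one-edge estimate behind the domination of a time slab by percolation. -/
lemma edgeLaw_slabOpen_le {p s : I} {a b : ℝ} (hab : a ≤ b) :
    ENNReal.ofReal s * edgeLaw {w | SlabOpen p a b True w} +
      ENNReal.ofReal (1 - s) * edgeLaw {w | SlabOpen p a b False w} ≤
      ENNReal.ofReal (max (s : ℝ) p + (b - a)) := by
  set N : ℕ → ℝ≥0∞ := fun k ↦ edgeLaw {w | CountEq a k w} with hN
  set M : ℝ≥0∞ := edgeLaw ((⋃ k, {w | CountEq a (k + 1) w ∧ σ p ≤ (w k).2}) ∪
    ⋃ k, {w | CountEq a k w ∧ arrival w (k + 1) ≤ b}) with hM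
  have hTrue : edgeLaw {w | SlabOpen p a b True w} ≤ N 0 + M := by
    refine (measure_mono ?_).trans (measure_union_le _ _)
    intro w hw
    simpa [SlabOpen] using hw
  have hFalse : edgeLaw {w | SlabOpen p a b False w} ≤ M := by
    refine measure_mono ?_
    intro w hw
    simpa [SlabOpen] using hw
  have hM' : M ≤ ENNReal.ofReal p * (∑' k, N (k + 1)) + ENNReal.ofReal (b - a) := by
    refine (measure_union_le _ _).trans (add_le_add ?_ ?_)
    · refine (measure_iUnion_le _).trans ?_
      rw [← ENNReal.tsum_mul_left]
      refine ENNReal.tsum_le_tsum fun k ↦ ?_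
      rw [edgeLaw_countEq_mark, mul_comm]
    · refine (measure_iUnion_le _).trans ((ENNReal.tsum_le_tsum fun k ↦
        edgeLaw_countEq_next_le hab k).trans ?_)
      rw [ENNReal.tsum_mul_left]
      exact mul_le_of_le_one_right' (tsum_edgeLaw_countEq_le a)
  have hsum : N 0 + ∑' k, N (k + 1) ≤ 1 := by
    have := tsum_edgeLaw_countEq_le a
    rwa [tsum_eq_zero_add' ENNReal.summable] at this
  have hs1 : ENNReal.ofReal s + ENNReal.ofReal (1 - s) = 1 := by
    rw [← ENNReal.ofReal_add s.2.1 (sub_nonneg.2 s.2.2)]; simp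
  -- The weight is `s` without any update before the slab and `p` after at least one. These two
  -- cases have total mass at most `1`, hence the maximum; an update during the slab adds at most `b
  -- - a`.
  calc _ ≤ ENNReal.ofReal s * (N 0 + M) + ENNReal.ofReal (1 - s) * M := by gcongr
    _ = ENNReal.ofReal s * N 0 + M := by
        rw [mul_add, add_assoc, ← add_mul, hs1, one_mul]
    _ ≤ ENNReal.ofReal s * N 0 +
        (ENNReal.ofReal p * (∑' k, N (k + 1)) + ENNReal.ofReal (b - a)) := by gcongr
    _ ≤ ENNReal.ofReal (max (s : ℝ) p) * N 0 +
        (ENNReal.ofReal (max (s : ℝ) p) * (∑' k, N (k + 1)) + ENNReal.ofReal (b - a)) := by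
        gcongr
        · exact le_max_left _ _
        · exact le_max_right _ _
    _ = ENNReal.ofReal (max (s : ℝ) p) * (N 0 + ∑' k, N (k + 1)) + ENNReal.ofReal (b - a) := by ring
    _ ≤ ENNReal.ofReal (max (s : ℝ) p) * 1 + ENNReal.ofReal (b - a) := by gcongr
    _ = ENNReal.ofReal (max (s : ℝ) p + (b - a)) := by
        rw [mul_one, ENNReal.ofReal_add (le_max_of_le_left s.2.1) (by linarith)]

end Renewal


/-! ### Domination of a time slab by percolation -/

section PropLaw

/-- The law of a proposition which is true with probability `s`. -/
noncomputable def propLaw (s : I) : Measure Prop :=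
  toNNReal s • Measure.dirac True + toNNReal (σ s) • Measure.dirac False

instance (s : I) : IsProbabilityMeasure (propLaw s) := by unfold propLaw; infer_instance

lemma coe_toNNReal_eq_ofReal (s : I) : ((toNNReal s : NNReal) : ℝ≥0∞) = ENNReal.ofReal s := by
  rw [ENNReal.ofReal, ENNReal.coe_inj]
  ext
  simp [Real.coe_toNNReal _ s.2.1]

lemma propLaw_apply (s : I) (A : Set Prop) : propLaw s A =
    ENNReal.ofReal s * A.indicator 1 True + ENNReal.ofReal (1 - s) * A.indicator 1 False := by
  simp [propLaw, ENNReal.smul_def, coe_toNNReal_eq_ofReal]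

lemma eq_propLaw (μ : Measure Prop) [IsProbabilityMeasure μ] :
    μ = propLaw ⟨μ.real {True}, measureReal_nonneg, measureReal_le_one⟩ := by
  have hc : ({False} : Set Prop) = {True}ᶜ := by
    ext q; by_cases hq : q <;> simp [hq]
  refine Measure.ext_of_singleton fun q ↦ ?_
  rw [propLaw_apply]
  by_cases hq : q
  · simp [hq]
  · simp only [hq]
    rw [hc, ← ofReal_measureReal, probReal_compl_eq_one_sub .of_discrete]
    simp

end PropLaw

section Slab

variable {V : Type} {G : SimpleGraph V} {B : Set G.edgeSet}

/-- The edges of `B` which may be open at some time of `(a, b]`. -/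
def slabSet (p : I) (a b : ℝ) (z : Set B) (ω : Updates G) : Set B :=
  {e | SlabOpen p a b (e ∈ z) fun k ↦ ω (e, k)}

lemma measurable_slabOpen (p : I) (a b : ℝ) :
    Measurable fun y : Prop × (ℕ → ℝ × I) ↦ SlabOpen p a b y.1 y.2 :=
  measurable_from_prod_countable_right fun z ↦
    measurable_to_prop (by simpa using measurableSet_slabOpen p a b z)

instance : IsProbabilityMeasure (updateLaw G) := by unfold updateLaw; infer_instance

lemma updateLaw_map_curry (B : Set G.edgeSet) :
    (updateLaw G).map (fun (ω : Updates G) (e : B) (k : ℕ) ↦ ω (e, k)) =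
      Measure.infinitePi fun _ : B ↦ edgeLaw := by
  have hinj : Function.Injective fun q : B × ℕ ↦ ((q.1 : G.edgeSet), q.2) := by
    rintro ⟨e, k⟩ ⟨e', k'⟩ h
    simpa [Subtype.ext_iff] using h
  have h := Measure.map_infinitePi_infinitePi_of_inj
    (P := fun _ : G.edgeSet × ℕ ↦ (expMeasure 1).prod (volume : Measure I)) hinj
  unfold edgeLaw
  rw [← Measure.infinitePi_map_curry (fun (_ : B) (_ : ℕ) ↦ (expMeasure 1).prod (volume : Measure I)),
    ← h, Measure.map_map (by fun_prop) (by fun_prop)]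
  rfl

lemma slabSet_mono {p : I} {a b : ℝ} {z z' : Set B} (h : z ⊆ z') (ω : Updates G) :
    slabSet p a b z ω ⊆ slabSet p a b z' ω := by
  rintro e (⟨h1, h2⟩ | h1)
  · exact .inl ⟨h h1, h2⟩
  · exact .inr h1

lemma isUpperSet_farIn (G : SimpleGraph V) (S : Set V) (m : ℕ) (x : V) :
    IsUpperSet (farIn G S m x) := by
  rintro X Y h ⟨y, hy, hn⟩
  exact ⟨y, hy.mono (openIn_mono G subset_rfl h), hn⟩

/-- The edges of `V` corresponding to a set of edges of `B`. -/
def toSym2 (Y : Set B) : Set (Sym2 V) := {e | ∃ f ∈ Y, ((f : G.edgeSet) : Sym2 V) = e}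

variable [Fintype B]

/-- Under percolation and independent updates, the edges which may be open during a short time
interval form a percolation of slightly larger parameter. -/
lemma exists_map_slabSet {p s : I} {a b : ℝ} (hab : a ≤ b) :
    ∃ t : I, (t : ℝ) ≤ max (s : ℝ) p + (b - a) ∧
      ((perc B s).prod (updateLaw G)).map (fun x ↦ slabSet p a b x.1 x.2) =
        setBernoulli (Set.univ : Set B) t := by
  -- Every edge applies the same `g` to its own initial state and updates, so the outcomes are
  -- independent and identically distributed. Their parameter `t` is only bounded, not computed.
  let g : Prop × (ℕ → ℝ × I) → Prop := fun y ↦ SlabOpen p a b y.1 y.2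
  have hg : Measurable g := measurable_slabOpen p a b
  have : IsProbabilityMeasure (((propLaw s).prod edgeLaw).map g) :=
    Measure.isProbabilityMeasure_map hg.aemeasurable
  let t : I := ⟨(((propLaw s).prod edgeLaw).map g).real {True}, measureReal_nonneg,
    measureReal_le_one⟩
  refine ⟨t, ?_, ?_⟩
  · change (((propLaw s).prod edgeLaw).map g).real {True} ≤ _
    have hnn : 0 ≤ max (s : ℝ) p + (b - a) :=
      add_nonneg (le_max_of_le_left s.2.1) (sub_nonneg.2 hab)
    rw [measureReal_def]
    refine ENNReal.toReal_le_of_le_ofReal hnn (le_trans (le_of_eq ?_)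
      (edgeLaw_slabOpen_le (p := p) (s := s) hab))
    rw [Measure.map_apply hg .of_discrete,
      Measure.prod_apply (hg (MeasurableSet.of_discrete (s := {True})))]
    have : ∀ z : Prop, edgeLaw (Prod.mk z ⁻¹' (g ⁻¹' {True})) =
        edgeLaw {w | SlabOpen p a b z w} := by
      intro z
      congr 1
      ext w
      simp [g]
    simp only [this]
    rw [propLaw, lintegral_add_measure, lintegral_smul_measure, lintegral_smul_measure,
      lintegral_dirac, lintegral_dirac]
    simp [ENNReal.smul_def, coe_toNNReal_eq_ofReal]
  · have hset : Measurable fun f : B → Prop ↦ {e | f e} := MeasurableEquiv.setOfPred.measurable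
    let U : Updates G → B → ℕ → ℝ × I := fun ω e k ↦ ω (e, k)
    have hU : Measurable U := by fun_prop
    let Φ : (B → Prop) × (B → ℕ → ℝ × I) → B → Prop × (ℕ → ℝ × I) := fun x e ↦ (x.1 e, x.2 e)
    have hΦ : Measurable Φ := by fun_prop
    have e1 : ((Measure.infinitePi fun _ : B ↦ propLaw s).prod
        (Measure.infinitePi fun _ : B ↦ edgeLaw)).map Φ =
        Measure.infinitePi fun _ : B ↦ (propLaw s).prod edgeLaw := by
      rw [Measure.infinitePi_eq_pi, Measure.infinitePi_eq_pi, Measure.infinitePi_eq_pi]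
      exact (measurePreserving_arrowProdEquivProdArrow Prop (ℕ → ℝ × I) B
        (fun _ ↦ propLaw s) (fun _ ↦ edgeLaw)).symm.map_eq
    rw [← updateLaw_map_curry, ← Measure.map_id (μ := Measure.infinitePi fun _ : B ↦ propLaw s),
      Measure.map_prod_map _ _ measurable_id hU, Measure.map_map hΦ (by fun_prop)] at e1
    have e2 := congrArg (Measure.map fun (y : B → Prop × (ℕ → ℝ × I)) (e : B) ↦ g (y e)) e1
    rw [Measure.infinitePi_map_pi _ (fun _ ↦ hg), eq_propLaw (((propLaw s).prod edgeLaw).map g),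
      Measure.map_map (by fun_prop) (by fun_prop)] at e2
    have e3 := congrArg (Measure.map fun f : B → Prop ↦ {e | f e}) e2
    rw [Measure.map_map hset (by fun_prop)] at e3
    rw [setBernoulli_univ_eq_map]
    refine Eq.trans ?_ e3
    rw [perc, setBernoulli_univ_eq_map, ← Measure.map_id (μ := updateLaw G),
      Measure.map_prod_map _ _ hset measurable_id, Measure.map_map ?_ (by fun_prop), Measure.map_id]
    · rfl
    · refine measurable_set_iff.2 fun e ↦ ?_
      exact hg.comp (((measurable_set_mem e).comp measurable_fst).prodMk (by fun_prop))

/-- Domination of a time slab by percolation. -/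
lemma real_slabSet_le {p s t : I} {a b : ℝ} (hab : a ≤ b) (ht : max (s : ℝ) p + (b - a) ≤ t)
    {ν : Measure (Set B)} [IsProbabilityMeasure ν] (hν : StochDom ν (perc B s))
    {A : Set (Set B)} (hA : IsUpperSet A) :
    (ν.prod (updateLaw G)).real {x | slabSet p a b x.1 x.2 ∈ A} ≤
      (setBernoulli (Set.univ : Set B) t).real A := by
  have hprob' : IsProbabilityMeasure (perc B s) := by unfold perc; infer_instance
  obtain ⟨t', ht', hmap⟩ := exists_map_slabSet (G := G) (B := B) (p := p) (s := s) hab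
  have hm : Measurable fun x : Set B × Updates G ↦ slabSet p a b x.1 x.2 := by
    refine measurable_set_iff.2 fun e ↦ ?_
    exact (measurable_slabOpen p a b).comp
      (((measurable_set_mem e).comp measurable_fst).prodMk (by fun_prop))
  have hmA : MeasurableSet {x : Set B × Updates G | slabSet p a b x.1 x.2 ∈ A} :=
    hm (measurableSet_of_finite A)
  refine le_trans ?_ (setBernoulli_real_mono hA (show t' ≤ t from ht'.trans ht))
  rw [← hmap, map_measureReal_apply hm (measurableSet_of_finite A)]
  refine ENNReal.toReal_mono (measure_ne_top _ _) ?_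
  change ν.prod (updateLaw G) {x | slabSet p a b x.1 x.2 ∈ A} ≤
    (perc B s).prod (updateLaw G) {x | slabSet p a b x.1 x.2 ∈ A}
  rw [Measure.prod_apply_symm hmA, Measure.prod_apply_symm hmA]
  -- With the updates fixed, `slabSet` increases with the initial configuration, so domination
  -- applies under the integral.
  refine lintegral_mono fun ω ↦ hν _ ?_ (measurableSet_of_finite _)
  intro z z' hz hzA
  exact hA (slabSet_mono hz ω) hzA

/-- All the clusters of the edges possibly open during a slab are small, with high probability. -/
lemma real_slabSet_far_le [Fintype V] {p s t : I} {a b : ℝ} (hab : a ≤ b)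
    (ht : max (s : ℝ) p + (b - a) ≤ t)
    {ν : Measure (Set B)} [IsProbabilityMeasure ν] (hν : StochDom ν (perc B s)) (m : ℕ) {ε : ℝ}
    (hε : ∀ x, (setBernoulli Set.univ t).real (farIn G Set.univ m x) ≤ ε) :
    (ν.prod (updateLaw G)).real
      {x | ∃ v, toSym2 (slabSet p a b x.1 x.2) ∈ farIn G Set.univ m v} ≤ Fintype.card V * ε := by
  have hA : IsUpperSet {Y : Set B | ∃ v, toSym2 Y ∈ farIn G Set.univ m v} := by
    rintro Y Y' h ⟨v, hv⟩
    refine ⟨v, isUpperSet_farIn G _ _ _ ?_ hv⟩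
    rintro e ⟨f, hf, rfl⟩
    exact ⟨f, h hf, rfl⟩
  refine (real_slabSet_le hab ht hν hA).trans ?_
  have hinj : Function.Injective fun f : B ↦ ((f : G.edgeSet) : Sym2 V) :=
    Subtype.val_injective.comp Subtype.val_injective
  rw [← setBernoulli_preimage hinj t (measurableSet_of_finite _)]
  refine (measureReal_mono (s₂ := ⋃ v, farIn G Set.univ m v) ?_).trans
    ((measureReal_iUnion_fintype_le _).trans ((Finset.sum_le_sum fun v _ ↦ hε v).trans ?_))
  · rintro X ⟨v, hv⟩
    refine Set.mem_iUnion.2 ⟨v, isUpperSet_farIn G _ _ _ ?_ hv⟩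
    rintro e ⟨f, hf, rfl⟩
    exact hf
  · simp

end Slab


/-! ### Cut-edges and the creation of discrepancies -/

section CutEdge

variable {V : Type} {G : SimpleGraph V}

lemma openGraph_adj {X : Config G} {a b : V} :
    (openGraph G X).Adj a b ↔ ∃ f ∈ X, (f : Sym2 V) = s(a, b) := by
  simp only [openGraph, SimpleGraph.fromEdgeSet_adj]
  constructor
  · rintro ⟨⟨f, hf, h⟩, -⟩
    exact ⟨f, hf, h⟩
  · rintro ⟨f, hf, h⟩
    have := f.2
    rw [h] at this
    exact ⟨⟨f, hf, h⟩, SimpleGraph.Adj.ne this⟩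

lemma openGraph_mono {X Y : Config G} (h : X ⊆ Y) : openGraph G X ≤ openGraph G Y := by
  intro a b hab
  obtain ⟨f, hf, he⟩ := openGraph_adj.1 hab
  exact openGraph_adj.2 ⟨f, h hf, he⟩

lemma isCutEdge_iff [Finite V] {X : Config G} {e : G.edgeSet} {u v : V}
    (he : (e : Sym2 V) = s(u, v)) :
    IsCutEdge G X e ↔ ¬ (openGraph G (X \ {e})).Reachable u v := by
  have hle : openGraph G (X \ {e}) ≤ openGraph G (X ∪ {e}) :=
    openGraph_mono (Set.sdiff_subset.trans Set.subset_union_left)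
  have hadj : (openGraph G (X ∪ {e})).Adj u v := openGraph_adj.2 ⟨e, by simp, he⟩
  unfold IsCutEdge numComponents
  rw [ne_eq, not_iff_not]
  constructor
  · intro hcard
    -- Opening `e` can only merge components; equal finite counts force this surjection to be
    -- injective.
    let φ : (openGraph G (X \ {e})).ConnectedComponent → (openGraph G (X ∪ {e})).ConnectedComponent :=
      SimpleGraph.ConnectedComponent.map (SimpleGraph.Hom.ofLE hle)
    have hsurj : Function.Surjective φ := by
      intro c
      induction c using SimpleGraph.ConnectedComponent.ind with
      | h w => exact ⟨(openGraph G (X \ {e})).connectedComponentMk w, rfl⟩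
    have hbij := hsurj.bijective_of_nat_card_le hcard.le
    refine SimpleGraph.ConnectedComponent.exact (hbij.1 ?_)
    exact SimpleGraph.ConnectedComponent.sound hadj.reachable
  · intro hr
    refine Nat.card_congr (Quot.congrRight fun a b ↦ ⟨fun h ↦ h.mono hle, fun h ↦ ?_⟩)
    refine mem_of_reachable (C := {w | (openGraph G (X \ {e})).Reachable a w}) ?_ h (.refl _)
    intro c d hc hcd
    obtain ⟨f, hf, hfe⟩ := openGraph_adj.1 hcd
    by_cases hef : f = e
    · subst hef
      rw [he] at hfe
      rcases Sym2.eq_iff.1 hfe with ⟨rfl, rfl⟩ | ⟨rfl, rfl⟩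
      · exact SimpleGraph.Reachable.trans hc hr
      · exact SimpleGraph.Reachable.trans hc hr.symm
    · refine SimpleGraph.Reachable.trans hc (SimpleGraph.Adj.reachable (openGraph_adj.2 ⟨f, ?_, hfe⟩))
      rcases hf with hf | hf
      · exact ⟨hf, hef⟩
      · exact absurd hf hef

/-- If the status of `e` differs in `X` and in `Y`, then `e` is connected by common open edges to
an edge where `X` and `Y` differ. -/
lemma exists_discrepancy_of_isCutEdge [Finite V] {X Y : Config G} {e : G.edgeSet}
    (hX : IsCutEdge G X e) (hY : ¬ IsCutEdge G Y e) {u v : V} (he : (e : Sym2 V) = s(u, v)) :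
    ∃ f : G.edgeSet, f ∈ Y ∧ f ∉ X ∧
      ∃ a ∈ (f : Sym2 V), (openGraph G (X ∩ Y)).Reachable u a := by
  rw [isCutEdge_iff he] at hX hY
  rw [not_not] at hY
  -- The cluster of `u` along common open edges other than `e` misses `v`, as `e` is a cut-edge in
  -- `X`. A path in `Y` from `u` to `v` leaves it through an edge closed in `X`.
  obtain ⟨a, b, ha, hb, hab⟩ := exists_adj_of_reachable
    (C := {w | (openGraph G ((X ∩ Y) \ {e})).Reachable u w}) hY (.refl _)
    (fun h ↦ hX (SimpleGraph.Reachable.mono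
      (openGraph_mono (Set.sdiff_subset_sdiff_left Set.inter_subset_left)) h))
  obtain ⟨f, hf, hfe⟩ := openGraph_adj.1 hab
  refine ⟨f, hf.1, fun hfX ↦ hb ?_, a, by rw [hfe]; simp,
    SimpleGraph.Reachable.mono (openGraph_mono Set.sdiff_subset) ha⟩
  exact SimpleGraph.Reachable.trans ha
    (SimpleGraph.Adj.reachable (openGraph_adj.2 ⟨f, ⟨⟨hfX, hf.1⟩, hf.2⟩, hfe⟩))

lemma mem_update_of_ne {p q : ℝ} {X : Config G} {e f : G.edgeSet} (u : ℝ) (h : f ≠ e) :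
    f ∈ update G p q X e u ↔ f ∈ X := by
  unfold update
  split_ifs <;> simp [h]

lemma le_of_mem_update_self {p q : ℝ} {X : Config G} {e : G.edgeSet} {u : ℝ}
    (h : e ∈ update G p q X e u) : 1 - p ≤ u := by
  by_contra hu
  rw [update, if_pos (not_le.1 hu)] at h
  exact h.2 rfl

/-- The mark is shared, so the outcomes can differ only in the branch that consults the cut-edge
status. -/
lemma isCutEdge_of_update_ne {p q : ℝ} {X Y : Config G} {e : G.edgeSet} {u : ℝ}
    (h : ¬ (e ∈ update G p q X e u ↔ e ∈ update G p q Y e u)) :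
    ¬ (IsCutEdge G X e ↔ IsCutEdge G Y e) := by
  intro hiff
  apply h
  unfold update
  rw [hiff]
  split_ifs <;> simp

end CutEdge

/-! ### The dynamics as a fold over the updates -/

section Dynamics

variable {V : Type} {G : SimpleGraph V}

open Classical in
/-- The censored dynamics after the updates of the list `l`. -/
noncomputable def runList (p q : ℝ) (B : Set G.edgeSet) (ω : Updates G) (x : Config G)
    (l : List (G.edgeSet × ℕ)) : Config G :=
  l.foldl (fun X a => if a.1 ∈ B then update G p q X a.1 ((ω a).2 : ℝ) else X) x

variable {p : I} {q : ℝ} {B : Set G.edgeSet} {ω : Updates G} {x : Config G}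

lemma runList_concat_of_mem {l : List (G.edgeSet × ℕ)} {a : G.edgeSet × ℕ} (ha : a.1 ∈ B) :
    runList p q B ω x (l ++ [a]) =
      update G p q (runList p q B ω x l) a.1 ((ω a).2 : ℝ) := by
  simp [runList, ha]

lemma runList_concat_of_notMem {l : List (G.edgeSet × ℕ)} {a : G.edgeSet × ℕ} (ha : a.1 ∉ B) :
    runList p q B ω x (l ++ [a]) = runList p q B ω x l := by
  simp [runList, ha]

lemma mem_runList_concat_of_ne {l : List (G.edgeSet × ℕ)} {a : G.edgeSet × ℕ} {f : G.edgeSet}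
    (h : f ≠ a.1) : f ∈ runList p q B ω x (l ++ [a]) ↔ f ∈ runList p q B ω x l := by
  by_cases ha : a.1 ∈ B
  · rw [runList_concat_of_mem ha, mem_update_of_ne _ h]
  · rw [runList_concat_of_notMem ha]

lemma mem_runList_of_notMem {f : G.edgeSet} (hf : f ∉ B) (l : List (G.edgeSet × ℕ)) :
    f ∈ runList p q B ω x l ↔ f ∈ x := by
  induction l using List.reverseRecOn with
  | nil => rfl
  | append_singleton l a ih =>
    rw [← ih]
    by_cases ha : a.1 ∈ B
    · exact mem_runList_concat_of_ne fun h ↦ hf (h ▸ ha)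
    · rw [runList_concat_of_notMem ha]

/-- An open edge was either initially open and never updated, or opened at its last update. -/
lemma mem_runList {L l : List (G.edgeSet × ℕ)}
    (hsort : L.Pairwise fun a b ↦ updateTime ω a ≤ updateTime ω b) (hl : l <+: L)
    {f : G.edgeSet} (hf : f ∈ B) (h : f ∈ runList p q B ω x l) :
    ((∀ k, (f, k) ∉ l) ∧ f ∈ x) ∨ ∃ k, (f, k) ∈ l ∧ σ p ≤ (ω (f, k)).2 ∧
      ∀ k', (f, k') ∈ l → updateTime ω (f, k') ≤ updateTime ω (f, k) := by
  induction l using List.reverseRecOn with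
  | nil => exact .inl ⟨by simp, h⟩
  | append_singleton l a ih =>
    by_cases hfa : f = a.1
    · obtain ⟨e, k⟩ := a
      change f = e at hfa
      subst hfa
      rw [runList_concat_of_mem hf] at h
      refine .inr ⟨k, by simp, le_of_mem_update_self h, fun k' hk' ↦ ?_⟩
      rcases List.mem_append.1 hk' with hk' | hk'
      · have := (hsort.sublist hl.sublist)
        exact (List.pairwise_append.1 this).2.2 _ hk' _ (by simp)
      · rw [List.mem_singleton.1 hk']
    · rw [mem_runList_concat_of_ne hfa] at h
      have hmem : ∀ k, (f, k) ∈ l ++ [a] ↔ (f, k) ∈ l := by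
        intro k
        simp only [List.mem_append, List.mem_singleton, or_iff_left_iff_imp]
        rintro rfl
        exact absurd rfl hfa
      simp only [hmem]
      exact ih ((List.prefix_append l [a]).trans hl) h

end Dynamics

section Arrival

variable {w : ℕ → ℝ × I}

lemma arrival_strictMono (hw : ∀ k, 0 < (w k).1) : StrictMono (arrival w) := by
  refine strictMono_nat_of_lt_succ fun k ↦ ?_
  rw [arrival, arrival, Finset.sum_range_succ]
  linarith [hw k]

lemma exists_countEq {a b : ℝ} (ha : 0 ≤ a) {m : ℕ} (hw : ∀ k, 0 < (w k).1)
    (h1 : a < arrival w m) (h2 : arrival w m ≤ b) :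
    ∃ k, CountEq a k w ∧ arrival w (k + 1) ≤ b := by
  classical
  have hex : ∃ i, a < arrival w i := ⟨m, h1⟩
  have hpos : Nat.find hex ≠ 0 := by
    intro h0
    have := Nat.find_spec hex
    rw [h0] at this
    simp only [arrival, Finset.range_zero, Finset.sum_empty] at this
    linarith
  obtain ⟨k, hk⟩ := Nat.exists_eq_succ_of_ne_zero hpos
  refine ⟨k, ⟨fun i hi ↦ ?_, ?_⟩, ?_⟩
  · exact not_lt.1 (Nat.find_min hex (by omega))
  · have := Nat.find_spec hex
    rwa [hk] at this
  · refine ((arrival_strictMono hw).monotone ?_).trans h2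
    rw [← Nat.succ_eq_add_one, ← hk]
    exact Nat.find_min' hex h1

end Arrival

/-! ### Speed of propagation of discrepancies -/

section Propagation

variable {V : Type} {G : SimpleGraph V} {B : Set G.edgeSet} {ω : Updates G} {p : I}

lemma updateTime_eq_arrival (e : G.edgeSet) (k : ℕ) :
    updateTime ω (e, k) = arrival (fun j ↦ ω (e, j)) (k + 1) := rfl

lemma mem_slabSet_of_updateTime (hω : ∀ a, 0 < (ω a).1) {z : Set B} {a b : ℝ} (ha : 0 ≤ a) {e : B}
    {k : ℕ} (h1 : a < updateTime ω (e, k)) (h2 : updateTime ω (e, k) ≤ b) :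
    e ∈ slabSet p a b z ω :=
  .inr (.inr (exists_countEq (w := fun j ↦ ω (e, j)) ha (fun _ ↦ hω _) h1 h2))

/-- Just before an update at a time of `(a, b]`, the open edges belong to `slabSet p a b`. -/
lemma mem_slabSet_of_mem_runList {q : ℝ} {x : Config G} {z : Set B} (hω : ∀ a, 0 < (ω a).1)
    (hx : ∀ e : B, (e : G.edgeSet) ∈ x ↔ e ∈ z) {L l : List (G.edgeSet × ℕ)}
    (hsort : L.Pairwise fun a b ↦ updateTime ω a ≤ updateTime ω b) (hl : l <+: L) {a b τ : ℝ}
    (ha : 0 ≤ a) (haτ : a < τ) (hτb : τ ≤ b) (hle : ∀ c ∈ l, updateTime ω c ≤ τ)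
    (hge : ∀ c ∉ l, τ ≤ updateTime ω c) {f : B} (hf : (f : G.edgeSet) ∈ runList p q B ω x l) :
    f ∈ slabSet p a b z ω := by
  have hmono := arrival_strictMono (w := fun j ↦ ω (f, j)) fun k ↦ hω _
  -- The alternatives of `SlabOpen` appear as: never updated, last updated by time `a`, or last
  -- updated inside the slab.
  rcases mem_runList hsort hl f.2 hf with ⟨h1, h2⟩ | ⟨k, hk, hmark, hlast⟩
  · refine .inl ⟨(hx f).1 h2, ?_, ?_⟩
    · intro i hi
      rw [Nat.le_zero.1 hi]
      simpa [arrival] using ha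
    · exact haτ.trans_le (hge _ (h1 0))
  · have hnext : ((f : G.edgeSet), k + 1) ∉ l := by
      intro h
      have := hlast _ h
      rw [updateTime_eq_arrival, updateTime_eq_arrival] at this
      exact absurd this (not_le.2 (hmono (Nat.lt_succ_self _)))
    by_cases hka : updateTime ω (f, k) ≤ a
    · refine .inr (.inl ⟨k, ⟨fun i hi ↦ ?_, ?_⟩, hmark⟩)
      · exact (hmono.monotone hi).trans hka
      · exact haτ.trans_le (hge _ hnext)
    · exact mem_slabSet_of_updateTime hω ha (not_le.1 hka) ((hle _ hk).trans hτb)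

lemma openGraph_le_openIn {X : Config G} {Y : Set B} (h : ∀ f ∈ X, ∃ hf : f ∈ B, ⟨f, hf⟩ ∈ Y) :
    openGraph G X ≤ openIn G Set.univ (toSym2 Y) := by
  intro a b hab
  obtain ⟨f, hf, hfe⟩ := openGraph_adj.1 hab
  obtain ⟨hfB, hfY⟩ := h f hf
  have := f.2
  rw [hfe] at this
  exact ⟨this, ⟨_, hfY, hfe⟩, trivial, trivial⟩

lemma exists_slab {η τ : ℝ} (hη : 0 < η) (hτ : 0 < τ) :
    ∃ j : ℕ, j * η < τ ∧ τ ≤ (j + 1 : ℕ) * η := by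
  have hpos : 0 < ⌈τ / η⌉₊ := Nat.ceil_pos.2 (div_pos hτ hη)
  obtain ⟨j, hj⟩ := Nat.exists_eq_succ_of_ne_zero hpos.ne'
  refine ⟨j, ?_, ?_⟩
  · rw [← lt_div_iff₀ hη]
    exact Nat.lt_ceil.1 (by omega)
  · rw [← div_le_iff₀ hη, ← Nat.succ_eq_add_one, ← hj]
    exact Nat.le_ceil _

lemma slab_le_of_lt {η τ τ' : ℝ} (hη : 0 < η) {i j : ℕ} (hi : i * η < τ) (hj : τ' ≤ (j + 1 : ℕ) * η)
    (h : τ ≤ τ') : i ≤ j := by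
  have h1 : (i : ℝ) * η < (j + 1 : ℕ) * η := by linarith
  have h2 : (i : ℝ) < (j + 1 : ℕ) := lt_of_mul_lt_mul_right h1 hη.le
  have h3 : i < j + 1 := by exact_mod_cast h2
  omega

variable [Finite V] {q : ℝ} {z : Set B} {η : ℝ} {J R : ℕ}

/-- Discrepancies enter from outside `B` and travel at most a distance `R` in each time slab. -/
lemma discrepancy_near (hη : 0 < η) (hω : ∀ a, 0 < (ω a).1)
    (hR : ∀ j < J, ∀ v, toSym2 (slabSet p (j * η) ((j + 1 : ℕ) * η) z ω) ∉ farIn G Set.univ R v)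
    {L l : List (G.edgeSet × ℕ)} {t : ℝ} (htJ : t ≤ J * η)
    (hsort : L.Pairwise fun a b ↦ updateTime ω a ≤ updateTime ω b)
    (hL : ∀ c, c ∈ L ↔ updateTime ω c ≤ t) (hl : l <+: L) {e : G.edgeSet} (he : e ∈ B)
    (hdiff : ¬ (e ∈ runList p q B ω (glue B z Set.univ) l ↔ e ∈ runList p q B ω (glue B z ∅) l)) :
    ∃ k, (e, k) ∈ l ∧ ∀ j : ℕ, j * η < updateTime ω (e, k) →
      updateTime ω (e, k) ≤ (j + 1 : ℕ) * η → ∀ u ∈ (e : Sym2 V), ∃ v,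
        (openIn G Set.univ (toSym2 (slabSet p (j * η) ((j + 1 : ℕ) * η) z ω))).Reachable u v ∧
        ∃ g ∉ B, ∃ w ∈ (g : Sym2 V), Near G (j * R) v w := by
  have hglue : ∀ ξ : Config G, ∀ f : B, (f : G.edgeSet) ∈ glue B z ξ ↔ f ∈ z := by
    intro ξ f
    simp [glue]
  have hpos : ∀ c, 0 < updateTime ω c := fun c ↦ Finset.sum_pos (fun _ _ ↦ hω _) (by simp)
  -- The claim separates the cluster of the current slab from the distance `j * R` due to earlier
  -- ones, so that several jumps in a slab are not charged separately. It covers both endpoints, as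
  -- a later discrepancy may attach to either.
  induction l using List.reverseRecOn generalizing e with
  | nil =>
    exfalso
    exact hdiff ((hglue _ ⟨e, he⟩).trans (hglue _ ⟨e, he⟩).symm)
  | append_singleton l a ih =>
    have hl' : l <+: L := (List.prefix_append l [a]).trans hl
    by_cases hea : e = a.1
    swap
    · rw [mem_runList_concat_of_ne hea, mem_runList_concat_of_ne hea] at hdiff
      obtain ⟨k, hk, h⟩ := ih hl' he hdiff
      exact ⟨k, List.mem_append_left _ hk, h⟩
    obtain ⟨e', k⟩ := a
    change e = e' at hea
    subst hea
    refine ⟨k, by simp, fun j hj1 hj2 ↦ ?_⟩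
    set τ := updateTime ω (e, k) with hτ
    have hτt : τ ≤ t := (hL _).1 (hl.subset (by simp))
    have hle : ∀ c ∈ l, updateTime ω c ≤ τ := fun c hc ↦
      (List.pairwise_append.1 (hsort.sublist hl.sublist)).2.2 c hc _ (by simp)
    have hge : ∀ c ∉ l, τ ≤ updateTime ω c := by
      intro c hc
      by_cases hcL : c ∈ L
      · obtain ⟨r, rfl⟩ := hl
        rw [List.append_assoc, List.pairwise_append] at hsort
        rcases List.mem_append.1 hcL with h | h
        · rcases List.mem_append.1 h with h | h
          · exact absurd h hc
          · rw [List.mem_singleton.1 h]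
        · exact (List.pairwise_cons.1 hsort.2.1).1 c h
      · exact hτt.trans (not_le.1 (mt (hL c).2 hcL)).le
    have hj0 : 0 ≤ (j : ℝ) * η := by positivity
    set Y := slabSet p (j * η) ((j + 1 : ℕ) * η) z ω with hY
    set H := openIn G Set.univ (toSym2 Y) with hH
    set X₁ := runList p q B ω (glue B z Set.univ) l with hX₁
    set X₂ := runList p q B ω (glue B z ∅) l with hX₂
    rw [runList_concat_of_mem he, runList_concat_of_mem he] at hdiff
    have hcut := isCutEdge_of_update_ne hdiff
    -- The lower dynamics is closed outside `B`, so common open edges lie in `B`, where `slabSet`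
    -- records them.
    have hout : ∀ f ∈ X₂, f ∈ B := by
      intro f hf
      by_contra hfB
      rw [hX₂, mem_runList_of_notMem hfB] at hf
      simp [glue, hfB] at hf
    have hsub : openGraph G (X₁ ∩ X₂) ≤ H := by
      refine openGraph_le_openIn fun f hf ↦ ⟨hout f hf.2, ?_⟩
      exact mem_slabSet_of_mem_runList hω (hglue ∅) hsort hl' hj0 hj1 hj2 hle hge
        (f := ⟨f, hout f hf.2⟩) hf.2
    have hdisc : ∀ u v, (e : Sym2 V) = s(u, v) → ∃ f : G.edgeSet, ¬ (f ∈ X₁ ↔ f ∈ X₂) ∧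
        ∃ a ∈ (f : Sym2 V), H.Reachable u a := by
      intro u v huv
      by_cases h1 : IsCutEdge G X₁ e
      · have h2 : ¬ IsCutEdge G X₂ e := fun h2 ↦ hcut ⟨fun _ ↦ h2, fun _ ↦ h1⟩
        obtain ⟨f, hf1, hf2, b, hb, hr⟩ := exists_discrepancy_of_isCutEdge h1 h2 huv
        exact ⟨f, by tauto, b, hb, hr.mono hsub⟩
      · have h2 : IsCutEdge G X₂ e := by tauto
        obtain ⟨f, hf1, hf2, b, hb, hr⟩ := exists_discrepancy_of_isCutEdge h2 h1 huv
        exact ⟨f, by tauto, b, hb, hr.mono (Set.inter_comm X₁ X₂ ▸ hsub)⟩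
    intro u hu
    obtain ⟨v, huv⟩ := Sym2.mem_iff_exists.1 hu
    obtain ⟨f, hf, b, hb, hr⟩ := hdisc u v huv
    by_cases hfB : f ∈ B
    swap
    · exact ⟨b, hr, f, hfB, b, hb, (Near.refl G b).mono (Nat.zero_le _)⟩
    obtain ⟨k', hk', hnear⟩ := ih hl' hfB hf
    obtain ⟨j', hj1', hj2'⟩ := exists_slab hη (hpos (f, k'))
    obtain ⟨v', hv', g, hg, w, hw, hvw⟩ := hnear j' hj1' hj2' b hb
    have hjj : j' ≤ j := slab_le_of_lt hη hj1' hj2 (hle _ hk')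
    -- In the same slab, the two connections concatenate within one cluster. If the earlier
    -- discrepancy dates from a previous slab, its cluster costs `R`, paid for by `j' + 1 ≤ j`.
    rcases hjj.eq_or_lt with rfl | hlt
    · exact ⟨v', hr.trans hv', g, hg, w, hw, hvw⟩
    · refine ⟨b, hr, g, hg, w, hw, ?_⟩
      have hj'J : j' < J := by
        have : (j' : ℝ) * η < J * η := hj1'.trans_le (((hL _).1 (hl'.subset hk')).trans htJ)
        exact_mod_cast lt_of_mul_lt_mul_right this hη.le
      have hb' : Near G R b v' := by
        by_contra hn
        exact hR j' hj'J b ⟨v', hv', hn⟩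
      refine (hb'.trans hvw).mono ?_
      calc R + j' * R = (j' + 1) * R := by ring
        _ ≤ j * R := Nat.mul_le_mul_right R hlt

/-- If the clusters of all the time slabs are small, then the boundary condition is not felt. -/
theorem dynFull_inter_eq_dynEmpty_inter (hη : 0 < η) (hω : ∀ a, 0 < (ω a).1)
    (hR : ∀ j < J, ∀ v, toSym2 (slabSet p (j * η) ((j + 1 : ℕ) * η) z ω) ∉ farIn G Set.univ R v)
    {r : ℝ} (hr : ((J * R : ℕ) : ℝ) ≤ r) {A : Set G.edgeSet} (hB : B = enlarge G r A) {t : ℝ}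
    (htJ : t ≤ J * η) : dynFull G p q B z ω t ∩ A = dynEmpty G p q B z ω t ∩ A := by
  classical
  have hAB : ∀ e ∈ A, e ∈ B := by
    intro e he
    rw [hB]
    have hu : (e : Sym2 V).out.1 ∈ (e : Sym2 V) := Sym2.out_fst_mem _
    exact ⟨e, he, _, hu, _, hu, .refl _, by
      rw [SimpleGraph.dist_self]; exact le_trans (Nat.cast_le.2 (Nat.zero_le _)) hr⟩
  have hpos : ∀ c, 0 < updateTime ω c := fun c ↦ Finset.sum_pos (fun _ _ ↦ hω _) (by simp)
  have hrun : ∀ x, censored G p q B x ω t = runList p q B ω x (updatesUpTo ω t) := fun x ↦ rfl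
  suffices h : ∀ e ∈ A, e ∈ dynFull G p q B z ω t ↔ e ∈ dynEmpty G p q B z ω t by
    ext e
    simp only [Set.mem_inter_iff, and_congr_left_iff]
    exact h e
  intro e he
  unfold dynFull dynEmpty
  rw [hrun, hrun]
  -- With infinitely many updates the list is `[]`, and both dynamics still have their common
  -- initial state on `A ⊆ B`.
  by_cases hfin : {a | updateTime ω a ≤ t}.Finite
  swap
  · rw [updatesUpTo, dif_neg hfin]
    simp [runList, glue, hAB e he]
  have hsort : (updatesUpTo ω t).Pairwise fun a b ↦ updateTime ω a ≤ updateTime ω b := by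
    rw [updatesUpTo, dif_pos hfin]
    refine (List.pairwise_mergeSort ?_ ?_ _).imp fun h ↦ of_decide_eq_true h
    · intro a b c h1 h2
      simp only [decide_eq_true_eq] at *
      exact h1.trans h2
    · intro a b
      simpa using le_total _ _
  have hL : ∀ c, c ∈ updatesUpTo ω t ↔ updateTime ω c ≤ t := by
    intro c
    rw [updatesUpTo, dif_pos hfin]
    simp
  by_contra hdiff
  obtain ⟨k, hk, h⟩ := discrepancy_near hη hω hR htJ hsort hL (List.prefix_refl _) (hAB e he) hdiff
  obtain ⟨j, hj1, hj2⟩ := exists_slab hη (hpos (e, k))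
  obtain ⟨u, hu⟩ : ∃ u, u ∈ (e : Sym2 V) := ⟨_, Sym2.out_fst_mem _⟩
  obtain ⟨v, huv, g, hg, w, hw, hvw⟩ := h j hj1 hj2 u hu
  have hjJ : j < J := by
    have : (j : ℝ) * η < J * η := hj1.trans_le (((hL _).1 hk).trans htJ)
    exact_mod_cast lt_of_mul_lt_mul_right this hη.le
  have huv' : Near G R u v := by
    by_contra hn
    exact hR j hjJ u ⟨v, huv, hn⟩
  -- The edge `g` outside `B` is within `(j + 1) * R ≤ J * R ≤ r` of `e ∈ A`, which would put it in
  -- `B`.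
  obtain ⟨W, hW⟩ := (huv'.trans hvw).symm
  apply hg
  rw [hB]
  refine ⟨e, he, w, hw, u, hu, ⟨W⟩, le_trans (Nat.cast_le.2 ?_) hr⟩
  refine (SimpleGraph.dist_le W).trans (hW.trans ?_)
  calc R + j * R = (j + 1) * R := by ring
    _ ≤ J * R := Nat.mul_le_mul_right R hjJ

end Propagation


/-! ### Union bound and choice of scales -/

section Conclusion

lemma updateLaw_exists_nonpos {V : Type} [Countable V] (G : SimpleGraph V) :
    updateLaw G {ω | ∃ a, (ω a).1 ≤ 0} = 0 := by
  have : Countable (Sym2 V) := Quot.mk_surjective.countable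
  rw [Set.ofPred_exists]
  refine measure_iUnion_null fun a ↦ ?_
  have h := (measurePreserving_eval_infinitePi
    (fun _ : G.edgeSet × ℕ ↦ (expMeasure 1).prod (volume : Measure I)) a).measure_preimage
    (measurableSet_Iic.prod MeasurableSet.univ : MeasurableSet (Set.Iic (0 : ℝ) ×ˢ Set.univ)).nullMeasurableSet
  rw [Measure.prod_prod, expMeasure_Iic_zero, zero_mul] at h
  rw [← h]
  unfold updateLaw
  congr 1
  ext ω
  simp

/-- The discrepancies do not reach `A`, with a probability controlled by the radius of the
clusters of percolation. -/
lemma one_sub_le_real_dyn_eq {V : Type} [Fintype V] {G : SimpleGraph V} {p s t : I} {q η : ℝ}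
    (hη : 0 < η) (ht : max (s : ℝ) p + η ≤ t) {J R : ℕ} {ε r T : ℝ}
    (hε : ∀ x, (setBernoulli Set.univ t).real (farIn G Set.univ R x) ≤ ε)
    (hr : ((J * R : ℕ) : ℝ) ≤ r) (hT : T ≤ J * η) {A B : Set G.edgeSet} (hB : B = enlarge G r A)
    {ν : Measure (Set B)} [IsProbabilityMeasure ν] (hν : StochDom ν (perc B s)) :
    1 - J * (Fintype.card V * ε) ≤ (ν.prod (updateLaw G)).real
      {x | ∀ t : ℝ, 0 ≤ t → t ≤ T →
        dynFull G p q B x.1 x.2 t ∩ A = dynEmpty G p q B x.1 x.2 t ∩ A} := by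
  have : Fintype B := Fintype.ofFinite B
  set P := ν.prod (updateLaw G)
  set good := {x : Set B × Updates G | ∀ t : ℝ, 0 ≤ t → t ≤ T →
    dynFull G p q B x.1 x.2 t ∩ A = dynEmpty G p q B x.1 x.2 t ∩ A}
  let bad : ℕ → Set (Set B × Updates G) := fun j ↦ {x | ∃ v,
    toSym2 (slabSet p (j * η) ((j + 1 : ℕ) * η) x.1 x.2) ∈ farIn G Set.univ R v}
  let null : Set (Set B × Updates G) := Set.univ ×ˢ {ω | ∃ a, (ω a).1 ≤ 0}
  have hnull : P.real null = 0 := by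
    rw [measureReal_def, Measure.prod_prod, updateLaw_exists_nonpos, mul_zero, ENNReal.toReal_zero]
  have hsub : goodᶜ ⊆ null ∪ ⋃ j ∈ Finset.range J, bad j := by
    intro x hx
    by_contra hcon
    apply hx
    simp only [Set.mem_union, Set.mem_iUnion, not_or, not_exists, Finset.mem_range] at hcon
    intro t _ htT
    refine dynFull_inter_eq_dynEmpty_inter hη (fun a ↦ ?_) (fun j hj v hv ↦ hcon.2 j hj ⟨v, hv⟩)
      hr hB (htT.trans hT)
    by_contra ha
    exact hcon.1 ⟨trivial, a, not_lt.1 ha⟩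
  have hbad : ∀ j, P.real (bad j) ≤ Fintype.card V * ε := fun j ↦
    real_slabSet_far_le (by push_cast; nlinarith) (by push_cast; linarith) hν R hε
  have h1 : P.real goodᶜ ≤ J * (Fintype.card V * ε) := by
    refine (measureReal_mono hsub (measure_ne_top _ _)).trans ((measureReal_union_le _ _).trans ?_)
    rw [hnull, zero_add]
    refine (measureReal_biUnion_finset_le _ _).trans
      ((Finset.sum_le_sum fun j _ ↦ hbad j).trans ?_)
    simp
  have h2 : (1 : ℝ) ≤ P.real good + P.real goodᶜ := by
    have := measureReal_union_le (μ := P) good goodᶜ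
    rwa [Set.union_compl_self, probReal_univ] at this
  linarith

/-- The choice of the radius of the clusters and of the number of time slabs. -/
lemma exists_scales {c η : ℝ} (hc0 : 0 < c) (hc1 : c < 1) (hη : 0 < η) (L d : ℕ) (hd : 1 ≤ d) :
    ∃ n₀ : ℕ, ∀ n : ℕ, n₀ ≤ n → ∃ J k : ℕ, Real.log n ^ 2 ≤ J * η ∧
      ((J * (k * L) : ℕ) : ℝ) ≤ Real.log n ^ 4 ∧
      J * ((n : ℝ) ^ d * c ^ k) ≤ 1 / (n : ℝ) ^ (3 * d) := by
  -- With `k ≥ K * log n`, this makes `c ^ k ≤ n ^ (-5d)`.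
  set K : ℝ := 5 * d / (-Real.log c) with hK
  have hlc : 0 < -Real.log c := neg_pos.2 (Real.log_neg hc0 hc1)
  have hK0 : 0 ≤ K := by positivity
  set C : ℝ := 1 / η + 1 with hC
  have hC1 : 1 ≤ C := by
    have : 0 < 1 / η := by positivity
    linarith
  -- For `log n ≥ M`, the second term absorbs the constant in `J * k * L = O(log³ n)`; the third
  -- gives `J ≤ n` through `x ^ 3 / 6 ≤ exp x`.
  set M : ℝ := 1 + C * (K + 1) * L + 6 * C with hM
  have hCK : 0 ≤ C * (K + 1) * L := by positivity
  refine ⟨⌈Real.exp M⌉₊, fun n hn ↦ ?_⟩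
  have hn' : Real.exp M ≤ n := (Nat.le_ceil _).trans (by exact_mod_cast hn)
  have hn0 : (0 : ℝ) < n := (Real.exp_pos M).trans_le hn'
  set x := Real.log n with hx
  have hxM : M ≤ x := (Real.le_log_iff_exp_le hn0).2 hn'
  have hexp : Real.exp x = n := Real.exp_log hn0
  have hx1 : 1 ≤ x := by linarith
  have hn1 : (1 : ℝ) ≤ n := by
    rw [← hexp]; exact Real.one_le_exp (by linarith)
  have hJ : (⌈x ^ 2 / η⌉₊ : ℝ) ≤ C * x ^ 2 := by
    have h1 := (Nat.ceil_lt_add_one (a := x ^ 2 / η) (by positivity)).le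
    have h2 : C * x ^ 2 = x ^ 2 / η + x ^ 2 := by rw [hC]; ring
    nlinarith
  have hk : (⌈K * x⌉₊ : ℝ) ≤ (K + 1) * x := by
    have h1 := (Nat.ceil_lt_add_one (a := K * x) (by positivity)).le
    linarith
  refine ⟨⌈x ^ 2 / η⌉₊, ⌈K * x⌉₊, ?_, ?_, ?_⟩
  · rw [← div_le_iff₀ hη]
    exact Nat.le_ceil _
  · push_cast
    calc (⌈x ^ 2 / η⌉₊ : ℝ) * (⌈K * x⌉₊ * L) ≤ (C * x ^ 2) * ((K + 1) * x * L) := by gcongr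
      _ = (C * (K + 1) * L) * x ^ 3 := by ring
      _ ≤ x * x ^ 3 := by gcongr; linarith
      _ = x ^ 4 := by ring
  · have hck : c ^ ⌈K * x⌉₊ ≤ 1 / (n : ℝ) ^ (5 * d) := by
      have h1 : 5 * d * x ≤ ⌈K * x⌉₊ * (-Real.log c) := by
        have h2 : K * x * (-Real.log c) = 5 * d * x := by
          rw [hK]; field_simp [(neg_pos.1 hlc).ne]
        rw [← h2]
        exact mul_le_mul_of_nonneg_right (Nat.le_ceil _) hlc.le
      have h3 : c ^ ⌈K * x⌉₊ = Real.exp (⌈K * x⌉₊ * Real.log c) := by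
        rw [Real.exp_nat_mul, Real.exp_log hc0]
      have h4 : (n : ℝ) ^ (5 * d) = Real.exp (5 * d * x) := by
        rw [← hexp, ← Real.exp_nat_mul]
        push_cast
        rfl
      rw [h3, h4, one_div, ← Real.exp_neg]
      exact Real.exp_le_exp.2 (by linarith)
    have hJn : (⌈x ^ 2 / η⌉₊ : ℝ) ≤ n := by
      refine hJ.trans ?_
      rw [← hexp]
      have h1 := Real.pow_div_factorial_le_exp x (by linarith) 3
      have h2 : ((3).factorial : ℝ) = 6 := by norm_num [Nat.factorial]
      rw [h2] at h1
      refine le_trans ?_ h1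
      rw [le_div_iff₀ (by norm_num)]
      calc C * x ^ 2 * 6 = (6 * C) * x ^ 2 := by ring
        _ ≤ x * x ^ 2 := by gcongr; linarith
        _ = x ^ 3 := by ring
    -- The slabs cost one power of `n` and the vertices `d` powers; `d + 1 ≤ 2 * d` leaves `3 * d`
    -- of the `5 * d`.
    calc (⌈x ^ 2 / η⌉₊ : ℝ) * ((n : ℝ) ^ d * c ^ ⌈K * x⌉₊)
        ≤ n * ((n : ℝ) ^ d * (1 / (n : ℝ) ^ (5 * d))) := by gcongr
      _ = (n : ℝ) ^ (d + 1) / (n : ℝ) ^ (5 * d) := by rw [pow_succ]; ring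
      _ ≤ (n : ℝ) ^ (2 * d) / (n : ℝ) ^ (5 * d) := by
          gcongr ?_ / _
          exact pow_le_pow_right₀ hn1 (by omega)
      _ = 1 / (n : ℝ) ^ (3 * d) := by
          rw [div_eq_div_iff (by positivity) (by positivity), ← pow_add, one_mul]
          congr 1
          ring

end Conclusion

end FK

theorem lemma3p11 (d : ℕ) (hd : 2 ≤ d) :
    ∃ p₀ : ℝ, 0 < p₀ ∧ ∀ p : I, 0 < (p : ℝ) → (p : ℝ) < p₀ →
      ∃ n₀ : ℕ, ∀ n : ℕ, n₀ ≤ n → ∀ q : ℝ, 1 < q →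
        ∀ A B : Set (FK.torus d n).edgeSet,
          B = FK.enlarge (FK.torus d n) (Real.log n ^ 4) A →
        ∀ ν : Measure (Set B), IsProbabilityMeasure ν →
          FK.StochDom ν (FK.perc B (FK.pInit d p)) →
          1 - 1 / (n : ℝ) ^ (3 * d) ≤
            (ν.prod (FK.updateLaw (FK.torus d n))).real
              {x | ∀ t : ℝ, 0 ≤ t → t ≤ Real.log n ^ 2 →
                FK.dynFull (FK.torus d n) p q B x.1 x.2 t ∩ A =
                  FK.dynEmpty (FK.torus d n) p q B x.1 x.2 t ∩ A} := by
  obtain ⟨p₀, hp₀, H⟩ := FK.exists_decay (d := d) (by omega)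
  refine ⟨p₀, hp₀, fun p _ hp ↦ ?_⟩
  obtain ⟨s, hps, his, c, hc0, hc1, L, N, hdecay⟩ := H p hp
  -- The slab length is the whole gap below the decay parameter `s`, so it does not depend on `n`.
  have hη : 0 < (s : ℝ) - max (FK.pInit d p : ℝ) p := sub_pos.2 (max_lt his hps)
  obtain ⟨n₀, hn₀⟩ := FK.exists_scales hc0 hc1 hη L d (by omega)
  -- The `1` rules out `ZMod 0`, which is infinite.
  refine ⟨max (max n₀ N) 1, fun n hn q _ A B hB ν hν hdom ↦ ?_⟩
  have : NeZero n := ⟨by omega⟩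
  obtain ⟨J, k, hJ, hJk, hbound⟩ := hn₀ n (by omega)
  have h := FK.one_sub_le_real_dyn_eq (q := q) hη (by linarith) (hdecay n (by omega) k) hJk hJ hB hdom
  refine le_trans ?_ h
  simp only [Fintype.card_pi, ZMod.card, Finset.prod_const, Finset.card_univ, Fintype.card_fin,
    Nat.cast_pow]
  linarith
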